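/- For $d\in\mathbb N$ let $g(t,x,y)=(4\pi t)^{-d/2}e^{-|y-x|^2/(4t)}$, $t>0$, $x,y\in\mathbb R^d$. For a Borel function $V:\mathbb R^d\to\mathbb R$ consider Borel measurable $G(t,x,y)\in[0,\infty]$ such that, for all $t>0$ and $x,y\in\mathbb R^d$, $$G(t,x,y)=g(t,x,y)+\int_0^t\int_{\mathbb R^d}G(s,x,z)\,V(z)\,g(t-s,z,y)\,dz\,ds ,\qquad (1)$$ where the integral with $V^-=\max\{0,-V\}$ in place of $V$ is required to be finite. The least such $G$, if there is one, is called the fundamental solution of $\partial_t=\Delta+V$ (the Schrödinger perturbation of $g$ by $V$). We say that $G$ has sharp global Gaussian bounds if there are numbers $0<c_1\le c_2<\infty$ such that $$c_1\le \frac{G(t,x,y)}{g(t,x,y)}\le c_2\qquad (2)$$ for all $t>0$, $x,y\in\mathbb R^d$; and that it has sharp local Gaussian bounds up to time $T\in(0,\infty)$ if there are such $c_1,c_2$ with (2) for all $0<t\le T$, $x,y\in\mathbb R^d$. Let $\varepsilon\in[0,1)$ and let $V_1=V_2:\mathbb R^3\to\mathbb R$ and $V:\mathbb R^6\to\mathbb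 R$ be $$V_1(x)=V_2(x)=-\frac{1-\varepsilon}{2}\,|x|^{-1-\varepsilon}\,\mathbf 1_{|x|<1},\qquad V(x_1,x_2)=V_1(x_1)V_2(x_2)\quad(x_1,x_2\in\mathbb R^3).$$ Then the fundamental solutions of $\partial_t=\Delta+V_1$ and $\partial_t=\Delta+V_2$ in $\mathbb R^3$ and of $\partial_t=\Delta+V$ in $\mathbb R^6$ exist. For $i=1,2$, the fundamental solution of $\partial_t=\Delta+V_i$, and indeed every solution of (1) with $V_i$ in place of $V$, has sharp global Gaussian bounds, and sharp local Gaussian bounds up to every time $T\in(0,\infty)$. The fundamental solution of $\partial_t=\Delta+V$, and indeed every solution of (1) on $\mathbb R^6$, has neither sharp global Gaussian bounds nor, for any $T\in(0,\infty)$, sharp local Gaussian bounds up to time $T$. -/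

import Mathlib

open MeasureTheory Set
open scoped ENNReal

noncomputable section

/-- Euclidean space `ℝ^d`. -/
abbrev RSpace (d : ℕ) : Type := EuclideanSpace ℝ (Fin d)

/-- The Gauss-Weierstrass kernel `g(t,x,y) = (4πt)^{-d/2} exp(-|y-x|²/(4t))` on `ℝ^d`
(used for `t > 0` only), the heat kernel of `∂_t = Δ`. -/
def gaussWeierstrass {d : ℕ} (t : ℝ) (x y : RSpace d) : ℝ :=
  (4 * Real.pi * t) ^ (-(d : ℝ) / 2) * Real.exp (-(‖y - x‖ ^ 2) / (4 * t))

/-- `∫_0^t ∫_{ℝ^d} G(s,x,z) W(z) g(t-s,z,y) dz ds`, for `G` and `W` with values in `[0,∞]`. -/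
def duhamelIntegral {d : ℕ} (W : RSpace d → ℝ≥0∞) (G : ℝ → RSpace d → RSpace d → ℝ≥0∞)
    (t : ℝ) (x y : RSpace d) : ℝ≥0∞ :=
  ∫⁻ s in Ioo 0 t, ∫⁻ z, G s x z * W z * ENNReal.ofReal (gaussWeierstrass (t - s) z y)

/-- `G ≥ 0` is Borel measurable and satisfies the Duhamel (perturbation) formula
`G(t,x,y) = g(t,x,y) + ∫_0^t ∫ G(s,x,z) V(z) g(t-s,z,y) dz ds` for all `t > 0` and all `x, y`.
The integral is understood as the difference of the integrals with `V⁺` and `V⁻` in place of `V`,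
the latter of which has to be finite; the value `+∞` of `G` is allowed.
The values of `G` at times `t ≤ 0` play no role. -/
structure IsDuhamelSolution {d : ℕ} (V : RSpace d → ℝ)
    (G : ℝ → RSpace d → RSpace d → ℝ≥0∞) : Prop where
  measurable : Measurable fun p : ℝ × RSpace d × RSpace d => G p.1 p.2.1 p.2.2
  finite_neg : ∀ t : ℝ, 0 < t → ∀ x y : RSpace d,
    duhamelIntegral (fun z => ENNReal.ofReal (-V z)) G t x y < ∞
  formula : ∀ t : ℝ, 0 < t → ∀ x y : RSpace d,
    G t x y + duhamelIntegral (fun z => ENNReal.ofReal (-V z)) G t x y =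
      ENNReal.ofReal (gaussWeierstrass t x y) +
        duhamelIntegral (fun z => ENNReal.ofReal (V z)) G t x y

/-- `G` is the fundamental solution of `∂_t = Δ + V`, i.e. the Schrödinger perturbation of the
Gauss-Weierstrass kernel by `V`: the solution of the Duhamel formula, where among several
`[0,∞]`-valued solutions (for `V ≥ 0`, the constant `+∞` may be another one) the least is
meant. For `V ≥ 0` this is the sum of the perturbation series. -/
structure IsFundamentalSolution {d : ℕ} (V : RSpace d → ℝ)
    (G : ℝ → RSpace d → RSpace d → ℝ≥0∞) : Prop extends IsDuhamelSolution V G where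
  least : ∀ H : ℝ → RSpace d → RSpace d → ℝ≥0∞, IsDuhamelSolution V H →
    ∀ t : ℝ, 0 < t → ∀ x y : RSpace d, G t x y ≤ H t x y

/-- The fundamental solution is unique. -/
theorem IsFundamentalSolution.unique {d : ℕ} {V : RSpace d → ℝ}
    {G H : ℝ → RSpace d → RSpace d → ℝ≥0∞} (hG : IsFundamentalSolution V G)
    (hH : IsFundamentalSolution V H) (t : ℝ) (ht : 0 < t) (x y : RSpace d) :
    G t x y = H t x y :=
  le_antisymm (hG.least H hH.toIsDuhamelSolution t ht x y)
    (hH.least G hG.toIsDuhamelSolution t ht x y)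

/-- Sharp Gaussian estimates, global in time: `c₁ ≤ G(t,x,y) / g(t,x,y) ≤ c₂` for all `t > 0`. -/
def SharpGaussianGlobal {d : ℕ} (G : ℝ → RSpace d → RSpace d → ℝ≥0∞) : Prop :=
  ∃ c₁ c₂ : ℝ, 0 < c₁ ∧ c₁ ≤ c₂ ∧ ∀ t : ℝ, 0 < t → ∀ x y : RSpace d,
    ENNReal.ofReal c₁ ≤ G t x y / ENNReal.ofReal (gaussWeierstrass t x y) ∧
      G t x y / ENNReal.ofReal (gaussWeierstrass t x y) ≤ ENNReal.ofReal c₂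

/-- Sharp Gaussian estimates, local in time: `c₁ ≤ G(t,x,y) / g(t,x,y) ≤ c₂` for `0 < t ≤ T`. -/
def SharpGaussianLocal {d : ℕ} (T : ℝ) (G : ℝ → RSpace d → RSpace d → ℝ≥0∞) : Prop :=
  ∃ c₁ c₂ : ℝ, 0 < c₁ ∧ c₁ ≤ c₂ ∧ ∀ t : ℝ, 0 < t → t ≤ T → ∀ x y : RSpace d,
    ENNReal.ofReal c₁ ≤ G t x y / ENNReal.ofReal (gaussWeierstrass t x y) ∧
      G t x y / ENNReal.ofReal (gaussWeierstrass t x y) ≤ ENNReal.ofReal c₂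

/-- The potential `-((1-ε)/2) |x|^{-1-ε} 1_{|x|<1}` on `ℝ^3`. -/
def ballPotential (ε : ℝ) : RSpace 3 → ℝ :=
  indicator {x | ‖x‖ < 1} fun x => -((1 - ε) / 2) * ‖x‖ ^ (-1 - ε)

/-- The tensor product `V(x₁,x₂) = V₁(x₁) V₂(x₂)` on `ℝ^{m+n} = ℝ^m × ℝ^n`. -/
def tensorPotential {m n : ℕ} (V₁ : RSpace m → ℝ) (V₂ : RSpace n → ℝ) : RSpace (m + n) → ℝ :=
  fun x => V₁ (WithLp.toLp 2 fun i => x (Fin.castAdd n i)) *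
    V₂ (WithLp.toLp 2 fun j => x (Fin.natAdd m j))

end

/-! Write `g` for the heat kernel, `W = -V₁ ≥ 0` for the absorption on ℝ³, and `D` for the Duhamel
operator of `W`. In dimension three the time integral of `g(s,x,z) g(t-s,z,y)` is at most `g(t,x,y)`
times the sum of the Newtonian kernels `1/(4π|z-x|)` and `1/(4π|z-y|)`
(`lintegral_heatKernel_mul_le`). The factor `(1-ε)/2` makes the Newtonian potential of `W` at most
1/2, so `D g ≤ g`. The part of `W` near the origin has a small potential and the rest is bounded, so
`D` halves `e^{lt} g` for a suitable `l` (`exists_isExpContraction_ballAbsorption`). This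
contraction gives existence by the alternating series, uniqueness, and the Chapman-Kolmogorov
equation.

The bound `G ≤ g` is immediate from absorption. For the lower bound, `G ≥ g - D g`, which says
nothing when only `D g ≤ g` is known; the aim is `D g ≤ (3/4) g`. For short times this follows from
the contraction, and Chapman-Kolmogorov carries the lower bound to any bounded time range. For all
times it holds when one endpoint has norm at least 3, where the potential is at most 1/4. For large
times the bridge midpoint has norm at least 3 with probability at least 1/2, so Chapman-Kolmogorov
at time `t/2` gives a uniform constant (`IsAbsorbedKernel.exists_lower_bound_of_ge`).

On ℝ⁶ the product of two nonpositive potentials is nonnegative, so `G` is at least the Duhamel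
integral of `g`. Near the origin, off a null set, `V` is at least a multiple of `|z|^{-2}`. On a
ball of radius comparable to `√s` this is of order `1/s`, while `g(s,0,z)` is of order `s^{-3}` and
the volume of order `s^3`. The time integrand at `x = y = 0` is thus at least a multiple of `1/s`,
which is not integrable, and `G(t,0,0) = ∞` for every `t > 0`. -/

/-- The Gauss-Weierstrass kernel with values in `[0,∞]`. -/
noncomputable def heatKernel {d : ℕ} (t : ℝ) (x y : RSpace d) : ℝ≥0∞ :=
  ENNReal.ofReal (gaussWeierstrass t x y)

/-! ### Heat kernel: bridge factorization, mass one, Chapman-Kolmogorov -/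

section GaussWeierstrass

variable {d : ℕ}

theorem gaussWeierstrass_pos {t : ℝ} (ht : 0 < t) (x y : RSpace d) :
    0 < gaussWeierstrass t x y := by
  unfold gaussWeierstrass
  positivity

theorem measurable_gaussWeierstrass :
    Measurable fun p : ℝ × RSpace d × RSpace d => gaussWeierstrass p.1 p.2.1 p.2.2 := by
  unfold gaussWeierstrass
  fun_prop

theorem measurable_heatKernel :
    Measurable fun p : ℝ × RSpace d × RSpace d => heatKernel p.1 p.2.1 p.2.2 :=
  measurable_gaussWeierstrass.ennreal_ofReal

theorem Measurable.heatKernel {α : Type*} [MeasurableSpace α] {τ : α → ℝ} {f h : α → RSpace d}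
    (hτ : Measurable τ) (hf : Measurable f) (hh : Measurable h) :
    Measurable fun a => heatKernel (τ a) (f a) (h a) :=
  measurable_heatKernel.comp (hτ.prodMk (hf.prodMk hh))

theorem heatKernel_ne_top (t : ℝ) (x y : RSpace d) : heatKernel t x y ≠ ∞ :=
  ENNReal.ofReal_ne_top

theorem heatKernel_ne_zero {t : ℝ} (ht : 0 < t) (x y : RSpace d) : heatKernel t x y ≠ 0 :=
  (ENNReal.ofReal_pos.2 (gaussWeierstrass_pos ht x y)).ne'

/-- The Gaussian bridge: the product of two heat kernels is a heat kernel times the density of a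
normal distribution. -/
theorem gaussWeierstrass_mul {s t : ℝ} (hs : 0 < s) (ht : 0 < t) (x y z : RSpace d) :
    gaussWeierstrass s x z * gaussWeierstrass t z y =
      gaussWeierstrass (s + t) x y *
        gaussWeierstrass (s * t / (s + t)) ((t / (s + t)) • x + (s / (s + t)) • y) z := by
  have hst : 0 < s + t := by positivity
  unfold gaussWeierstrass
  have h1 : (4 * Real.pi * s) ^ (-(d : ℝ) / 2) * (4 * Real.pi * t) ^ (-(d : ℝ) / 2) =
      (4 * Real.pi * (s + t)) ^ (-(d : ℝ) / 2) *
        (4 * Real.pi * (s * t / (s + t))) ^ (-(d : ℝ) / 2) := by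
    rw [← Real.mul_rpow (by positivity) (by positivity),
      ← Real.mul_rpow (by positivity) (by positivity)]
    congr 1
    field_simp
  have h2 : -(‖z - x‖ ^ 2) / (4 * s) + -(‖y - z‖ ^ 2) / (4 * t) =
      -(‖y - x‖ ^ 2) / (4 * (s + t)) +
        -(‖z - ((t / (s + t)) • x + (s / (s + t)) • y)‖ ^ 2) / (4 * (s * t / (s + t))) := by
    have e1 : y - x = (z - x) + (y - z) := by abel
    have e2 : z - ((t / (s + t)) • x + (s / (s + t)) • y) =
        (t / (s + t)) • (z - x) - (s / (s + t)) • (y - z) := by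
      have : t / (s + t) + s / (s + t) = 1 := by field_simp; ring
      have h3 : z = (t / (s + t)) • z + (s / (s + t)) • z := by
        rw [← add_smul, this, one_smul]
      rw [smul_sub, smul_sub]
      nth_rewrite 1 [h3]
      abel
    rw [e2, e1]
    generalize z - x = u
    generalize y - z = v
    rw [@norm_add_sq_real, @norm_sub_sq_real, norm_smul, norm_smul, real_inner_smul_left,
      real_inner_smul_right, Real.norm_of_nonneg (by positivity), Real.norm_of_nonneg (by positivity)]
    field_simp
    ring
  calc _ = ((4 * Real.pi * s) ^ (-(d : ℝ) / 2) * (4 * Real.pi * t) ^ (-(d : ℝ) / 2)) *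
      Real.exp (-(‖z - x‖ ^ 2) / (4 * s) + -(‖y - z‖ ^ 2) / (4 * t)) := by
        rw [Real.exp_add]; ring
    _ = _ := by
        rw [h1, h2, Real.exp_add]; ring

theorem heatKernel_mul {s t : ℝ} (hs : 0 < s) (ht : 0 < t) (x y z : RSpace d) :
    heatKernel s x z * heatKernel t z y =
      heatKernel (s + t) x y *
        heatKernel (s * t / (s + t)) ((t / (s + t)) • x + (s / (s + t)) • y) z := by
  unfold heatKernel
  rw [← ENNReal.ofReal_mul (gaussWeierstrass_pos hs _ _).le, gaussWeierstrass_mul hs ht,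
    ENNReal.ofReal_mul (gaussWeierstrass_pos (by positivity) _ _).le]

theorem integral_gaussWeierstrass {t : ℝ} (ht : 0 < t) (x : RSpace d) :
    ∫ y, gaussWeierstrass t x y = 1 := by
  have h := GaussianFourier.integral_rexp_neg_mul_sq_norm (V := RSpace d)
    (b := 1 / (4 * t)) (by positivity)
  unfold gaussWeierstrass
  rw [integral_const_mul, integral_sub_right_eq_self
    (fun v : RSpace d => Real.exp (-(‖v‖ ^ 2) / (4 * t)))]
  have e : (fun v : RSpace d => Real.exp (-(‖v‖ ^ 2) / (4 * t))) =
      fun v => Real.exp (-(1 / (4 * t)) * ‖v‖ ^ 2) := by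
    ext v; congr 1; ring
  rw [e, h, finrank_euclideanSpace, Fintype.card_fin,
    show Real.pi / (1 / (4 * t)) = 4 * Real.pi * t by field_simp, neg_div,
    ← Real.rpow_add (by positivity)]
  simp

theorem lintegral_heatKernel {t : ℝ} (ht : 0 < t) (x : RSpace d) :
    ∫⁻ y, heatKernel t x y = 1 := by
  have hi : Integrable (gaussWeierstrass t x) := by
    by_contra hcon
    have := integral_gaussWeierstrass ht x
    rw [integral_undef hcon] at this
    exact zero_ne_one this
  unfold heatKernel
  rw [← ofReal_integral_eq_lintegral_ofReal hi
    (Filter.Eventually.of_forall fun y => (gaussWeierstrass_pos ht x y).le),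
    integral_gaussWeierstrass ht x, ENNReal.ofReal_one]

/-- The Chapman-Kolmogorov equation for the heat kernel. -/
theorem lintegral_heatKernel_mul {s t : ℝ} (hs : 0 < s) (ht : 0 < t) (x y : RSpace d) :
    ∫⁻ z, heatKernel s x z * heatKernel t z y = heatKernel (s + t) x y := by
  simp_rw [heatKernel_mul hs ht]
  rw [lintegral_const_mul' _ _ (heatKernel_ne_top _ _ _),
    lintegral_heatKernel (by positivity), mul_one]

theorem heatKernel_le {t : ℝ} (ht : 0 < t) (x y : RSpace d) :
    heatKernel t x y ≤ ENNReal.ofReal ((4 * Real.pi * t) ^ (-(d : ℝ) / 2)) := by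
  unfold heatKernel gaussWeierstrass
  apply ENNReal.ofReal_le_ofReal
  apply mul_le_of_le_one_right (by positivity)
  rw [Real.exp_le_one_iff]
  apply div_nonpos_of_nonpos_of_nonneg _ (by positivity)
  simp

end GaussWeierstrass

/-! ### The Duhamel operator and the series for nonnegative potentials -/

section Duhamel

variable {d : ℕ} {W W' : RSpace d → ℝ≥0∞} {G H : ℝ → RSpace d → RSpace d → ℝ≥0∞}

theorem duhamelIntegral_eq (W : RSpace d → ℝ≥0∞) (G : ℝ → RSpace d → RSpace d → ℝ≥0∞)
    (t : ℝ) (x y : RSpace d) :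
    duhamelIntegral W G t x y =
      ∫⁻ s in Ioo 0 t, ∫⁻ z, G s x z * W z * heatKernel (t - s) z y := rfl

theorem measurable_duhamelIntegral (hW : Measurable W)
    (hG : Measurable fun p : ℝ × RSpace d × RSpace d => G p.1 p.2.1 p.2.2) :
    Measurable fun p : ℝ × RSpace d × RSpace d => duhamelIntegral W G p.1 p.2.1 p.2.2 := by
  have h1 : Measurable fun q : ((ℝ × RSpace d × RSpace d) × ℝ) × RSpace d =>
      G q.1.2 q.1.1.2.1 q.2 * W q.2 * heatKernel (q.1.1.1 - q.1.2) q.2 q.1.1.2.2 := by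
    refine Measurable.mul (Measurable.mul ?_ (hW.comp measurable_snd)) ?_
    · exact hG.comp (f := fun q : ((ℝ × RSpace d × RSpace d) × ℝ) × RSpace d =>
        (q.1.2, q.1.1.2.1, q.2)) (by fun_prop)
    · exact Measurable.heatKernel (by fun_prop) (by fun_prop) (by fun_prop)
  have h2 : Measurable fun q : (ℝ × RSpace d × RSpace d) × ℝ =>
      (Ioo 0 q.1.1).indicator (fun s => ∫⁻ z, G s q.1.2.1 z * W z *
        heatKernel (q.1.1 - s) z q.1.2.2) q.2 := by
    have hset : MeasurableSet {q : (ℝ × RSpace d × RSpace d) × ℝ | q.2 ∈ Ioo 0 q.1.1} := by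
      apply MeasurableSet.inter
      · exact measurableSet_lt measurable_const measurable_snd
      · exact measurableSet_lt measurable_snd (by fun_prop)
    exact (h1.lintegral_prod_right').indicator hset
  have h3 := h2.lintegral_prod_right' (ν := volume)
  convert h3 using 2 with p
  rw [duhamelIntegral_eq, ← lintegral_indicator measurableSet_Ioo]

theorem measurable_slice
    (hG : Measurable fun p : ℝ × RSpace d × RSpace d => G p.1 p.2.1 p.2.2)
    {α : Type*} [MeasurableSpace α] {τ : α → ℝ} {f h : α → RSpace d}
    (hτ : Measurable τ) (hf : Measurable f) (hh : Measurable h) :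
    Measurable fun a => G (τ a) (f a) (h a) :=
  hG.comp (hτ.prodMk (hf.prodMk hh))

theorem duhamelIntegral_mono {t : ℝ} {x : RSpace d} (y : RSpace d)
    (h : ∀ s ∈ Ioo 0 t, ∀ z, G s x z * W z ≤ H s x z * W' z) :
    duhamelIntegral W G t x y ≤ duhamelIntegral W' H t x y := by
  apply setLIntegral_mono' measurableSet_Ioo
  intro s hs
  apply lintegral_mono
  intro z
  exact mul_le_mul_left (h s hs z) _

theorem duhamelIntegral_mono_left {t : ℝ} {x : RSpace d} (y : RSpace d)
    (h : ∀ s ∈ Ioo 0 t, ∀ z, G s x z ≤ H s x z) :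
    duhamelIntegral W G t x y ≤ duhamelIntegral W H t x y :=
  duhamelIntegral_mono y fun s hs z => mul_le_mul_left (h s hs z) _

theorem duhamelIntegral_congr {t : ℝ} {x : RSpace d} (y : RSpace d)
    (h : ∀ s ∈ Ioo 0 t, ∀ z, G s x z = H s x z) :
    duhamelIntegral W G t x y = duhamelIntegral W H t x y :=
  le_antisymm (duhamelIntegral_mono_left y fun s hs z => (h s hs z).le)
    (duhamelIntegral_mono_left y fun s hs z => (h s hs z).ge)

theorem measurable_duhamel_integrand (hW : Measurable W)
    (hG : Measurable fun p : ℝ × RSpace d × RSpace d => G p.1 p.2.1 p.2.2)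
    (t : ℝ) (x y : RSpace d) :
    Measurable fun q : ℝ × RSpace d => G q.1 x q.2 * W q.2 * heatKernel (t - q.1) q.2 y :=
  ((measurable_slice hG (by fun_prop) (by fun_prop) (by fun_prop)).mul
    (hW.comp measurable_snd)).mul (Measurable.heatKernel (by fun_prop) (by fun_prop) (by fun_prop))

theorem duhamelIntegral_add (hW : Measurable W)
    (hG : Measurable fun p : ℝ × RSpace d × RSpace d => G p.1 p.2.1 p.2.2) (t : ℝ)
    (x y : RSpace d) :
    duhamelIntegral W (fun s x z => G s x z + H s x z) t x y =
      duhamelIntegral W G t x y + duhamelIntegral W H t x y := by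
  simp only [duhamelIntegral_eq, add_mul]
  rw [← lintegral_add_left]
  · congr 1 with s
    rw [lintegral_add_left]
    exact (measurable_duhamel_integrand hW hG t x y).comp (measurable_prodMk_left (x := s))
  · exact (measurable_duhamel_integrand hW hG t x y).lintegral_prod_right'

theorem duhamelIntegral_add_potential (hW : Measurable W)
    (hG : Measurable fun p : ℝ × RSpace d × RSpace d => G p.1 p.2.1 p.2.2) (t : ℝ)
    (x y : RSpace d) :
    duhamelIntegral (fun z => W z + W' z) G t x y =
      duhamelIntegral W G t x y + duhamelIntegral W' G t x y := by
  simp only [duhamelIntegral_eq, mul_add, add_mul]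
  rw [← lintegral_add_left]
  · congr 1 with s
    rw [lintegral_add_left]
    exact (measurable_duhamel_integrand hW hG t x y).comp (measurable_prodMk_left (x := s))
  · exact (measurable_duhamel_integrand hW hG t x y).lintegral_prod_right'

theorem duhamelIntegral_const_mul {c : ℝ≥0∞} (hc : c ≠ ∞) (t : ℝ) (x y : RSpace d) :
    duhamelIntegral W (fun s x z => c * G s x z) t x y = c * duhamelIntegral W G t x y := by
  simp only [duhamelIntegral_eq, mul_assoc, lintegral_const_mul' c _ hc]

theorem duhamelIntegral_zero (t : ℝ) (x y : RSpace d) :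
    duhamelIntegral (fun _ => 0) G t x y = 0 := by
  simp [duhamelIntegral_eq]

theorem duhamelIntegral_iSup (hW : Measurable W) {K : ℕ → ℝ → RSpace d → RSpace d → ℝ≥0∞}
    (hK : ∀ n, Measurable fun p : ℝ × RSpace d × RSpace d => K n p.1 p.2.1 p.2.2)
    (hmono : ∀ s x z, Monotone fun n => K n s x z) (t : ℝ) (x y : RSpace d) :
    duhamelIntegral W (fun s x z => ⨆ n, K n s x z) t x y =
      ⨆ n, duhamelIntegral W (K n) t x y := by
  simp only [duhamelIntegral_eq, ENNReal.iSup_mul]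
  rw [← lintegral_iSup]
  · congr 1 with s
    rw [lintegral_iSup]
    · exact fun n => (measurable_duhamel_integrand hW (hK n) t x y).comp
        (measurable_prodMk_left (x := s))
    · intro m n hmn z
      exact mul_le_mul_left (mul_le_mul_left (hmono s x z hmn) _) _
  · exact fun n => (measurable_duhamel_integrand hW (hK n) t x y).lintegral_prod_right'
  · intro m n hmn s
    refine lintegral_mono fun z => ?_
    exact mul_le_mul_left (mul_le_mul_left (hmono s x z hmn) _) _

/-- Composition with a kernel on the left commutes with the Duhamel operator. -/
theorem duhamelIntegral_lintegral_mul (hW : Measurable W) {p : RSpace d → ℝ≥0∞}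
    (hp : Measurable p)
    (hG : Measurable fun p : ℝ × RSpace d × RSpace d => G p.1 p.2.1 p.2.2)
    (t : ℝ) (x y : RSpace d) :
    duhamelIntegral W (fun s _ z => ∫⁻ w, p w * G s w z) t x y =
      ∫⁻ w, p w * duhamelIntegral W G t w y := by
  have hm : Measurable fun q : ((RSpace d × ℝ) × RSpace d) =>
      p q.1.1 * (G q.1.2 q.1.1 q.2 * W q.2 * heatKernel (t - q.1.2) q.2 y) :=
    Measurable.mul (hp.comp (by fun_prop))
      (((measurable_slice hG (by fun_prop) (by fun_prop) (by fun_prop)).mul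
        (hW.comp measurable_snd)).mul
        (Measurable.heatKernel (by fun_prop) (by fun_prop) (by fun_prop)))
  have hm' := hm.lintegral_prod_right' (ν := volume)
  have h1 : ∀ w, p w * duhamelIntegral W G t w y =
      ∫⁻ s in Ioo 0 t, ∫⁻ z, p w * (G s w z * W z * heatKernel (t - s) z y) := by
    intro w
    rw [duhamelIntegral_eq, ← lintegral_const_mul]
    · congr 1 with s
      rw [lintegral_const_mul]
      exact (measurable_duhamel_integrand hW hG t w y).comp (measurable_prodMk_left (x := s))
    · exact (measurable_duhamel_integrand hW hG t w y).lintegral_prod_right'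
  simp_rw [h1]
  rw [lintegral_lintegral_swap hm'.aemeasurable, duhamelIntegral_eq]
  congr 1 with s
  rw [lintegral_lintegral_swap]
  · congr 1 with z
    rw [mul_assoc, ← lintegral_mul_const]
    · simp only [mul_assoc]
    · exact hp.mul (measurable_slice hG (by fun_prop) (by fun_prop) (by fun_prop))
  · exact (hm.comp (f := fun q : RSpace d × RSpace d => ((q.1, s), q.2)) (by fun_prop)).aemeasurable

/-- The iterates of the Duhamel operator on the heat kernel. -/
noncomputable def duhamelIter (W : RSpace d → ℝ≥0∞) (n : ℕ) : ℝ → RSpace d → RSpace d → ℝ≥0∞ :=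
  (duhamelIntegral W)^[n] heatKernel

theorem duhamelIter_zero : duhamelIter W 0 = heatKernel := rfl

theorem duhamelIter_succ (n : ℕ) :
    duhamelIter W (n + 1) = duhamelIntegral W (duhamelIter W n) :=
  Function.iterate_succ_apply' _ _ _

theorem measurable_duhamelIter (hW : Measurable W) (n : ℕ) :
    Measurable fun p : ℝ × RSpace d × RSpace d => duhamelIter W n p.1 p.2.1 p.2.2 := by
  induction n with
  | zero => exact measurable_heatKernel
  | succ n ih => rw [duhamelIter_succ]; exact measurable_duhamelIntegral hW ih

/-- For a nonnegative potential the perturbation series is the fundamental solution. -/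
theorem exists_isFundamentalSolution_of_nonneg {V : RSpace d → ℝ} (hV : Measurable V)
    (hV0 : ∀ z, 0 ≤ V z) : ∃ G, IsFundamentalSolution V G := by
  set W : RSpace d → ℝ≥0∞ := fun z => ENNReal.ofReal (V z) with hWdef
  have hW : Measurable W := hV.ennreal_ofReal
  have hneg : (fun z => ENNReal.ofReal (-V z)) = fun _ => 0 := by
    ext z
    exact ENNReal.ofReal_of_nonpos (neg_nonpos.2 (hV0 z))
  let S : ℕ → ℝ → RSpace d → RSpace d → ℝ≥0∞ := fun n t x y =>
    ∑ k ∈ Finset.range n, duhamelIter W k t x y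
  have hSm : ∀ n, Measurable fun p : ℝ × RSpace d × RSpace d => S n p.1 p.2.1 p.2.2 := fun n =>
    Finset.measurable_fun_sum _ fun k _ => measurable_duhamelIter hW k
  have hSmono : ∀ t x y, Monotone fun n => S n t x y := fun t x y m n hmn =>
    Finset.sum_le_sum_of_subset (Finset.range_mono hmn)
  have hS : ∀ n t x y, S (n + 1) t x y = heatKernel t x y + duhamelIntegral W (S n) t x y := by
    intro n
    induction n with
    | zero =>
      intro t x y
      simp [S, duhamelIter_zero, duhamelIntegral_eq]
    | succ n ih =>
      intro t x y
      have h1 : S (n + 1) = fun s x z => S n s x z + duhamelIter W n s x z := by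
        ext s x z
        exact Finset.sum_range_succ _ _
      have h2 : S (n + 1 + 1) t x y = S (n + 1) t x y + duhamelIter W (n + 1) t x y :=
        Finset.sum_range_succ _ _
      rw [h2, ih, duhamelIter_succ, h1, duhamelIntegral_add hW (hSm n), add_assoc]
  refine ⟨fun t x y => ⨆ n, S n t x y, ⟨⟨Measurable.iSup hSm, ?_, ?_⟩, ?_⟩⟩
  · intro t _ x y
    rw [hneg, duhamelIntegral_zero]
    exact ENNReal.zero_lt_top
  · intro t _ x y
    rw [hneg, duhamelIntegral_zero, add_zero, duhamelIntegral_iSup hW hSm hSmono]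
    change _ = heatKernel t x y + _
    rw [ENNReal.add_iSup]
    simp_rw [← hS]
    exact ((hSmono t x y).iSup_nat_add 1).symm
  · intro H hH
    have key : ∀ n, ∀ t : ℝ, 0 < t → ∀ x y, S n t x y ≤ H t x y := by
      intro n
      induction n with
      | zero => intro t _ x y; simp [S]
      | succ n ih =>
        intro t ht x y
        rw [hS]
        have := hH.formula t ht x y
        rw [hneg, duhamelIntegral_zero, add_zero] at this
        rw [this]
        exact add_le_add_right (duhamelIntegral_mono_left y fun s hs z => ih s hs.1 x z) _
    intro t ht x y
    exact iSup_le fun n => key n t ht x y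

end Duhamel

/-! ### Absorption: uniqueness, existence, Chapman-Kolmogorov -/

section Absorption

variable {d : ℕ} {W : RSpace d → ℝ≥0∞} {G H : ℝ → RSpace d → RSpace d → ℝ≥0∞}

theorem le_of_forall_le_add_half_pow_mul {a b c : ℝ≥0∞} (hc : c ≠ ∞)
    (h : ∀ n : ℕ, a ≤ b + (1 / 2) ^ n * c) : a ≤ b := by
  have h1 : Filter.Tendsto (fun n : ℕ => b + (1 / 2 : ℝ≥0∞) ^ n * c) Filter.atTop
      (nhds (b + 0 * c)) := by
    refine tendsto_const_nhds.add (ENNReal.Tendsto.mul_const ?_ (Or.inr hc))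
    exact ENNReal.tendsto_pow_atTop_nhds_zero_of_lt_one (by simp)
  rw [zero_mul, add_zero] at h1
  exact ge_of_tendsto' h1 h

/-- Uniqueness for the Duhamel formula with absorption, in the class of kernels dominated by a
kernel on which the Duhamel operator is a contraction. -/
theorem eq_of_add_duhamelIntegral_eq (hW : Measurable W)
    (hG : Measurable fun p : ℝ × RSpace d × RSpace d => G p.1 p.2.1 p.2.2)
    (hH : Measurable fun p : ℝ × RSpace d × RSpace d => H p.1 p.2.1 p.2.2)
    {k : ℝ → RSpace d → RSpace d → ℝ≥0∞} (hk : ∀ t x y, k t x y ≠ ∞)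
    (hDk : ∀ t : ℝ, 0 < t → ∀ x y, duhamelIntegral W k t x y ≤ 1 / 2 * k t x y)
    (hGk : ∀ t : ℝ, 0 < t → ∀ x y, G t x y ≤ k t x y)
    (hHk : ∀ t : ℝ, 0 < t → ∀ x y, H t x y ≤ k t x y)
    (h : ∀ t : ℝ, 0 < t → ∀ x y,
      G t x y + duhamelIntegral W G t x y = H t x y + duhamelIntegral W H t x y)
    {t : ℝ} (ht : 0 < t) (x y : RSpace d) : G t x y = H t x y := by
  have hfin : ∀ {K : ℝ → RSpace d → RSpace d → ℝ≥0∞},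
      (∀ t : ℝ, 0 < t → ∀ x y, K t x y ≤ k t x y) → ∀ t : ℝ, 0 < t → ∀ x y,
        duhamelIntegral W K t x y ≠ ∞ := by
    intro K hK t ht x y
    refine ne_top_of_le_ne_top ?_ ((duhamelIntegral_mono_left y
      fun s hs z => hK s hs.1 x z).trans (hDk t ht x y))
    exact ENNReal.mul_ne_top (by simp) (hk t x y)
  -- In `[0,∞]` only truncated differences are available. The positive part of `K - L` is controlled
  -- by `D` applied to the positive part of `L - K`, so the two parts are bounded jointly and swap
  -- roles at each iteration.
  have step : ∀ {K L : ℝ → RSpace d → RSpace d → ℝ≥0∞},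
      (Measurable fun p : ℝ × RSpace d × RSpace d => K p.1 p.2.1 p.2.2) →
      (∀ t : ℝ, 0 < t → ∀ x y, K t x y ≤ k t x y) →
      (∀ t : ℝ, 0 < t → ∀ x y,
        K t x y + duhamelIntegral W K t x y = L t x y + duhamelIntegral W L t x y) →
      ∀ t : ℝ, 0 < t → ∀ x y,
        K t x y - L t x y ≤ duhamelIntegral W (fun s x z => L s x z - K s x z) t x y := by
    intro K L hKm hK hKL t ht x y
    rw [tsub_le_iff_left]
    have h1 : duhamelIntegral W L t x y ≤ duhamelIntegral W K t x y +
        duhamelIntegral W (fun s x z => L s x z - K s x z) t x y := by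
      rw [← duhamelIntegral_add hW hKm]
      exact duhamelIntegral_mono_left y fun s hs z => le_add_tsub
    have h2 : K t x y + duhamelIntegral W K t x y ≤
        (L t x y + duhamelIntegral W (fun s x z => L s x z - K s x z) t x y) +
          duhamelIntegral W K t x y := by
      rw [hKL t ht x y]
      refine (add_le_add_right h1 _).trans (le_of_eq ?_)
      ring
    exact (ENNReal.add_le_add_iff_right (hfin hK t ht x y)).1 h2
  have key : ∀ n : ℕ, ∀ t : ℝ, 0 < t → ∀ x y,
      G t x y - H t x y ≤ (1 / 2) ^ n * k t x y ∧ H t x y - G t x y ≤ (1 / 2) ^ n * k t x y := by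
    intro n
    induction n with
    | zero =>
      intro t ht x y
      rw [pow_zero, one_mul]
      exact ⟨tsub_le_self.trans (hGk t ht x y), tsub_le_self.trans (hHk t ht x y)⟩
    | succ n ih =>
      have aux : ∀ {K : ℝ → RSpace d → RSpace d → ℝ≥0∞},
          (∀ t : ℝ, 0 < t → ∀ x y, K t x y ≤ (1 / 2) ^ n * k t x y) →
          ∀ t : ℝ, 0 < t → ∀ x y, duhamelIntegral W K t x y ≤ (1 / 2) ^ (n + 1) * k t x y := by
        intro K hK t ht x y
        calc _ ≤ duhamelIntegral W (fun s x z => (1 / 2) ^ n * k s x z) t x y :=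
              duhamelIntegral_mono_left y fun s hs z => hK s hs.1 x z
          _ = (1 / 2) ^ n * duhamelIntegral W k t x y :=
              duhamelIntegral_const_mul (ENNReal.pow_ne_top (by simp)) _ _ _
          _ ≤ (1 / 2) ^ n * (1 / 2 * k t x y) := by gcongr; exact hDk t ht x y
          _ = _ := by rw [pow_succ, mul_assoc]
      intro t ht x y
      exact ⟨(step hG hGk h t ht x y).trans (aux (fun t ht x y => (ih t ht x y).2) t ht x y),
        (step hH hHk (fun t ht x y => (h t ht x y).symm) t ht x y).trans
          (aux (fun t ht x y => (ih t ht x y).1) t ht x y)⟩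
  apply le_antisymm <;> refine le_of_forall_le_add_half_pow_mul (hk t x y) fun n => ?_
  · exact tsub_le_iff_left.1 (key n t ht x y).1
  · exact tsub_le_iff_left.1 (key n t ht x y).2

/-- The heat kernel with an exponential weight in time. -/
noncomputable def expHeatKernel (l : ℝ) (t : ℝ) (x y : RSpace d) : ℝ≥0∞ :=
  ENNReal.ofReal (Real.exp (l * t)) * heatKernel t x y

theorem measurable_expHeatKernel (l : ℝ) :
    Measurable fun p : ℝ × RSpace d × RSpace d => expHeatKernel l p.1 p.2.1 p.2.2 := by
  unfold expHeatKernel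
  exact Measurable.mul (by fun_prop) measurable_heatKernel

theorem expHeatKernel_ne_top (l t : ℝ) (x y : RSpace d) : expHeatKernel l t x y ≠ ∞ :=
  ENNReal.mul_ne_top ENNReal.ofReal_ne_top (heatKernel_ne_top _ _ _)

theorem one_le_ofReal_exp {l t : ℝ} (hl : 0 ≤ l) (ht : 0 ≤ t) :
    1 ≤ ENNReal.ofReal (Real.exp (l * t)) := by
  rw [ENNReal.one_le_ofReal]
  exact Real.one_le_exp (by positivity)

theorem heatKernel_le_expHeatKernel {l t : ℝ} (hl : 0 ≤ l) (ht : 0 ≤ t) (x y : RSpace d) :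
    heatKernel t x y ≤ expHeatKernel l t x y :=
  le_mul_of_one_le_left zero_le (one_le_ofReal_exp hl ht)

/-- `G` solves the Duhamel formula with the absorption `W`. -/
structure IsAbsorbedKernel (W : RSpace d → ℝ≥0∞) (G : ℝ → RSpace d → RSpace d → ℝ≥0∞) :
    Prop where
  measurable : Measurable fun p : ℝ × RSpace d × RSpace d => G p.1 p.2.1 p.2.2
  formula : ∀ t : ℝ, 0 < t → ∀ x y, G t x y + duhamelIntegral W G t x y = heatKernel t x y

theorem IsAbsorbedKernel.le_heatKernel (hG : IsAbsorbedKernel W G) {t : ℝ} (ht : 0 < t)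
    (x y : RSpace d) : G t x y ≤ heatKernel t x y :=
  (hG.formula t ht x y) ▸ le_self_add

theorem IsAbsorbedKernel.duhamelIntegral_le (hG : IsAbsorbedKernel W G) {t : ℝ} (ht : 0 < t)
    (x y : RSpace d) : duhamelIntegral W G t x y ≤ heatKernel t x y :=
  (hG.formula t ht x y) ▸ le_add_self

/-- First-order lower bound, obtained by replacing `G` by the larger heat kernel inside the Duhamel
term. It is informative only where that term is a proper fraction of the heat kernel. -/
theorem IsAbsorbedKernel.heatKernel_le_add (hG : IsAbsorbedKernel W G) {t : ℝ} (ht : 0 < t)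
    (x y : RSpace d) : heatKernel t x y ≤ G t x y + duhamelIntegral W heatKernel t x y := by
  rw [← hG.formula t ht x y]
  gcongr
  exact duhamelIntegral_mono_left y fun s hs z => hG.le_heatKernel hs.1 x z

/-- The Duhamel operator is a contraction with respect to an exponential weight in time. -/
def IsExpContraction (W : RSpace d → ℝ≥0∞) (l : ℝ) : Prop :=
  ∀ t : ℝ, 0 < t → ∀ x y,
    duhamelIntegral W (expHeatKernel l) t x y ≤ 1 / 2 * expHeatKernel l t x y

theorem IsAbsorbedKernel.eq (hW : Measurable W) {l : ℝ} (hl : 0 ≤ l)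
    (hc : IsExpContraction W l) (hG : IsAbsorbedKernel W G) (hH : IsAbsorbedKernel W H)
    {t : ℝ} (ht : 0 < t) (x y : RSpace d) : G t x y = H t x y :=
  eq_of_add_duhamelIntegral_eq hW hG.measurable hH.measurable (expHeatKernel_ne_top l) hc
    (fun _ ht x y => (hG.le_heatKernel ht x y).trans (heatKernel_le_expHeatKernel hl ht.le x y))
    (fun _ ht x y => (hH.le_heatKernel ht x y).trans (heatKernel_le_expHeatKernel hl ht.le x y))
    (fun t ht x y => (hG.formula t ht x y).trans (hH.formula t ht x y).symm) ht x y

theorem duhamelIter_le {l : ℝ} (hl : 0 ≤ l) (hc : IsExpContraction W l) (n : ℕ) {t : ℝ}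
    (ht : 0 < t) (x y : RSpace d) :
    duhamelIter W n t x y ≤ (1 / 2) ^ n * expHeatKernel l t x y := by
  induction n generalizing t y with
  | zero =>
    rw [pow_zero, one_mul]
    exact heatKernel_le_expHeatKernel hl ht.le x y
  | succ n ih =>
    rw [duhamelIter_succ]
    calc _ ≤ duhamelIntegral W (fun s x z => (1 / 2) ^ n * expHeatKernel l s x z) t x y :=
          duhamelIntegral_mono_left y fun s hs z => ih hs.1 z
      _ = (1 / 2) ^ n * duhamelIntegral W (expHeatKernel l) t x y :=
          duhamelIntegral_const_mul (ENNReal.pow_ne_top (by simp)) _ _ _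
      _ ≤ (1 / 2) ^ n * (1 / 2 * expHeatKernel l t x y) := by gcongr; exact hc t ht x y
      _ = _ := by rw [pow_succ, mul_assoc]

/-- Decreasing iterates make each pair of consecutive terms of the alternating series nonnegative,
so truncated subtraction loses nothing there. -/
theorem duhamelIter_succ_le
    (hle : ∀ t : ℝ, 0 < t → ∀ x y, duhamelIntegral W heatKernel t x y ≤ heatKernel t x y)
    (n : ℕ) {t : ℝ} (ht : 0 < t) (x y : RSpace d) :
    duhamelIter W (n + 1) t x y ≤ duhamelIter W n t x y := by
  induction n generalizing t y with
  | zero => exact hle t ht x y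
  | succ n ih =>
    rw [duhamelIter_succ, duhamelIter_succ n]
    refine duhamelIntegral_mono_left y fun s hs z => ?_
    rw [← duhamelIter_succ]
    exact ih hs.1 z

/-- The alternating perturbation series, summed in pairs, solves the Duhamel formula. -/
theorem exists_isAbsorbedKernel (hW : Measurable W) {l : ℝ} (hl : 0 ≤ l)
    (hc : IsExpContraction W l)
    (hle : ∀ t : ℝ, 0 < t → ∀ x y, duhamelIntegral W heatKernel t x y ≤ heatKernel t x y) :
    ∃ G, IsAbsorbedKernel W G := by
  let D : ℕ → ℝ → RSpace d → RSpace d → ℝ≥0∞ := fun k t x y =>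
    duhamelIter W (2 * k) t x y - duhamelIter W (2 * k + 1) t x y
  let S : ℕ → ℝ → RSpace d → RSpace d → ℝ≥0∞ := fun n t x y => ∑ k ∈ Finset.range n, D k t x y
  have hSm : ∀ n, Measurable fun p : ℝ × RSpace d × RSpace d => S n p.1 p.2.1 p.2.2 := fun n =>
    Finset.measurable_fun_sum _ fun k _ =>
      (measurable_duhamelIter hW _).sub (measurable_duhamelIter hW _)
  have hSmono : ∀ t x y, Monotone fun n => S n t x y := fun t x y m n hmn =>
    Finset.sum_le_sum_of_subset (Finset.range_mono hmn)
  have hDm : ∀ n, Measurable fun p : ℝ × RSpace d × RSpace d => D n p.1 p.2.1 p.2.2 := fun n =>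
    (measurable_duhamelIter hW _).sub (measurable_duhamelIter hW _)
  have hD : ∀ n (t : ℝ), 0 < t → ∀ x y,
      D n t x y + duhamelIter W (2 * n + 1) t x y = duhamelIter W (2 * n) t x y :=
    fun n t ht x y => tsub_add_cancel_of_le (duhamelIter_succ_le hle _ ht x y)
  -- Telescoping: after `n` pairs the Duhamel formula holds up to the iterate of order `2 * n`,
  -- which tends to zero geometrically by the contraction.
  have hS : ∀ n (t : ℝ), 0 < t → ∀ x y,
      S n t x y + duhamelIntegral W (S n) t x y + duhamelIter W (2 * n) t x y =
        heatKernel t x y := by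
    intro n
    induction n with
    | zero =>
      intro t _ x y
      simp [S, duhamelIter_zero, duhamelIntegral_eq]
    | succ n ih =>
      intro t ht x y
      have h1 : S (n + 1) = fun s x z => S n s x z + D n s x z := by
        ext s x z
        exact Finset.sum_range_succ _ _
      have h2 : duhamelIntegral W (D n) t x y + duhamelIter W (2 * (n + 1)) t x y =
          duhamelIter W (2 * n + 1) t x y := by
        rw [show 2 * (n + 1) = 2 * n + 1 + 1 by ring, duhamelIter_succ (2 * n + 1),
          ← duhamelIntegral_add hW (hDm n), duhamelIter_succ (2 * n)]
        refine duhamelIntegral_congr y fun s hs z => ?_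
        rw [← duhamelIter_succ]
        exact hD n s hs.1 x z
      rw [← ih t ht x y, ← hD n t ht x y, ← h2, h1, duhamelIntegral_add hW (hSm n)]
      ring
  refine ⟨fun t x y => ⨆ n, S n t x y, Measurable.iSup hSm, fun t ht x y => ?_⟩
  rw [duhamelIntegral_iSup hW hSm hSmono, ENNReal.iSup_add_iSup_of_monotone (hSmono t x y)
    (fun m n hmn => duhamelIntegral_mono_left y fun s _ z => hSmono s x z hmn)]
  apply le_antisymm
  · exact iSup_le fun n => (hS n t ht x y) ▸ le_self_add
  · refine le_of_forall_le_add_half_pow_mul (expHeatKernel_ne_top l t x y) fun n => ?_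
    nth_rewrite 1 [← hS n t ht x y]
    refine add_le_add
      (le_iSup (fun n => S n t x y + duhamelIntegral W (S n) t x y) n) ?_
    refine (duhamelIter_le hl hc (2 * n) ht x y).trans ?_
    gcongr ?_ * _
    exact pow_le_pow_of_le_one zero_le (by simp) (by omega)

theorem setLIntegral_Ioo_add (f : ℝ → ℝ≥0∞) (a b : ℝ) :
    ∫⁻ r in Ioo a (a + b), f r = ∫⁻ r in Ioo 0 b, f (a + r) := by
  rw [← lintegral_indicator measurableSet_Ioo, ← lintegral_indicator measurableSet_Ioo,
    ← lintegral_add_left_eq_self _ a]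
  congr 1 with r
  by_cases h : r ∈ Ioo 0 b
  · rw [indicator_of_mem h, indicator_of_mem]
    exact ⟨by linarith [h.1], by linarith [h.2]⟩
  · rw [indicator_of_notMem h, indicator_of_notMem]
    exact fun h' => h ⟨by linarith [h'.1], by linarith [h'.2]⟩

theorem setLIntegral_Ioo_split (f : ℝ → ℝ≥0∞) {a b : ℝ} (ha : 0 < a) (hb : 0 < b) :
    ∫⁻ r in Ioo 0 (a + b), f r = (∫⁻ r in Ioo 0 a, f r) + ∫⁻ r in Ioo 0 b, f (a + r) := by
  -- Two adjacent open intervals miss the point `a`; closing the first one on the right costs only a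
  -- null set.
  rw [← setLIntegral_Ioo_add, ← setLIntegral_congr (Ioo_ae_eq_Ioc (a := (0 : ℝ)) (b := a)).symm,
    ← lintegral_union measurableSet_Ioo, Ioc_union_Ioo_eq_Ioo ha.le (by linarith)]
  exact Set.disjoint_left.2 fun r h1 h2 => absurd h1.2 (not_le.2 h2.1)

/-- Splitting the Duhamel integral at an intermediate time. -/
theorem duhamelIntegral_add_time (hW : Measurable W)
    (hG : Measurable fun p : ℝ × RSpace d × RSpace d => G p.1 p.2.1 p.2.2)
    {τ s : ℝ} (hτ : 0 < τ) (hs : 0 < s) (x y : RSpace d) :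
    duhamelIntegral W G (τ + s) x y =
      (∫⁻ w, duhamelIntegral W G τ x w * heatKernel s w y) +
        duhamelIntegral W (fun r => G (τ + r)) s x y := by
  rw [duhamelIntegral_eq, setLIntegral_Ioo_split _ hτ hs, duhamelIntegral_eq]
  congr 1
  · have hm : Measurable fun q : ((RSpace d × ℝ) × RSpace d) =>
        G q.1.2 x q.2 * W q.2 * heatKernel (τ - q.1.2) q.2 q.1.1 * heatKernel s q.1.1 y :=
      (((measurable_slice hG (by fun_prop) (by fun_prop) (by fun_prop)).mul
        (hW.comp measurable_snd)).mul
        (Measurable.heatKernel (by fun_prop) (by fun_prop) (by fun_prop))).mul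
        (Measurable.heatKernel (by fun_prop) (by fun_prop) (by fun_prop))
    have h1 : ∀ w, duhamelIntegral W G τ x w * heatKernel s w y =
        ∫⁻ r in Ioo 0 τ, ∫⁻ z, G r x z * W z * heatKernel (τ - r) z w * heatKernel s w y := by
      intro w
      simp only [duhamelIntegral_eq, lintegral_mul_const' _ _ (heatKernel_ne_top s w y)]
    simp_rw [h1]
    symm
    rw [lintegral_lintegral_swap (hm.lintegral_prod_right' (ν := volume)).aemeasurable]
    refine setLIntegral_congr_fun measurableSet_Ioo fun r hr => ?_
    rw [lintegral_lintegral_swap]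
    · congr 1 with z
      simp only [mul_assoc (G r x z * W z)]
      rw [lintegral_const_mul, lintegral_heatKernel_mul (sub_pos.2 hr.2) hs]
      · congr 2; ring
      · exact (Measurable.heatKernel (by fun_prop) (by fun_prop) (by fun_prop)).mul
          (Measurable.heatKernel (by fun_prop) (by fun_prop) (by fun_prop))
    · exact (hm.comp (f := fun q : RSpace d × RSpace d => ((q.1, r), q.2))
        (by fun_prop)).aemeasurable
  · refine setLIntegral_congr_fun measurableSet_Ioo fun r _ => ?_
    simp only [add_sub_add_left_eq_sub]

/-- The Chapman-Kolmogorov equation for the perturbed kernel. -/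
theorem IsAbsorbedKernel.lintegral_mul (hW : Measurable W) {l : ℝ} (hl : 0 ≤ l)
    (hc : IsExpContraction W l) (hG : IsAbsorbedKernel W G) {τ s : ℝ} (hτ : 0 < τ) (hs : 0 < s)
    (x y : RSpace d) : ∫⁻ z, G τ x z * G s z y = G (τ + s) x y := by
  have hGm := hG.measurable
  -- With `τ` fixed, both sides are compared as functions of the second time. The majorant `k` is
  -- the heat kernel at time `τ` composed with the weighted kernel, so it inherits the contraction.
  let k : ℝ → RSpace d → RSpace d → ℝ≥0∞ := fun r x y =>
    ENNReal.ofReal (Real.exp (l * r)) * heatKernel (τ + r) x y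
  have hk : ∀ r : ℝ, 0 < r → ∀ x y,
      k r x y = ∫⁻ w, heatKernel τ x w * expHeatKernel l r w y := by
    intro r hr x y
    simp only [k, expHeatKernel]
    rw [← lintegral_heatKernel_mul hτ hr, ← lintegral_const_mul' _ _ ENNReal.ofReal_ne_top]
    congr 1 with w
    ring
  have hle : ∀ r : ℝ, 0 < r → ∀ x y, heatKernel (τ + r) x y ≤ k r x y := fun r hr x y =>
    le_mul_of_one_le_left zero_le (one_le_ofReal_exp hl hr.le)
  have hτm : ∀ x : RSpace d, Measurable (heatKernel τ x) := fun x =>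
    Measurable.heatKernel measurable_const measurable_const measurable_id
  have hGτm : ∀ x, Measurable (G τ x) := fun x =>
    measurable_slice hGm measurable_const measurable_const measurable_id
  refine eq_of_add_duhamelIntegral_eq (k := k) (G := fun s x y => ∫⁻ z, G τ x z * G s z y)
    (H := fun s => G (τ + s)) hW ?_ ?_ ?_ ?_ ?_ ?_ ?_ hs x y
  · have : Measurable fun q : (ℝ × RSpace d × RSpace d) × RSpace d =>
        G τ q.1.2.1 q.2 * G q.1.1 q.2 q.1.2.2 :=
      (measurable_slice hGm (by fun_prop) (by fun_prop) (by fun_prop)).mul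
        (measurable_slice hGm (by fun_prop) (by fun_prop) (by fun_prop))
    exact this.lintegral_prod_right'
  · exact measurable_slice hGm (by fun_prop) (by fun_prop) (by fun_prop)
  · exact fun r x y => ENNReal.mul_ne_top ENNReal.ofReal_ne_top (heatKernel_ne_top _ _ _)
  · intro r hr x y
    calc _ = duhamelIntegral W
          (fun s _ z => ∫⁻ w, heatKernel τ x w * expHeatKernel l s w z) r x y :=
          duhamelIntegral_congr y fun s hs z => hk s hs.1 x z
      _ = ∫⁻ w, heatKernel τ x w * duhamelIntegral W (expHeatKernel l) r w y :=
          duhamelIntegral_lintegral_mul hW (hτm x) (measurable_expHeatKernel l) r x y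
      _ ≤ ∫⁻ w, 1 / 2 * (heatKernel τ x w * expHeatKernel l r w y) := by
          refine lintegral_mono fun w => ?_
          refine (mul_le_mul_right (hc r hr w y) _).trans (le_of_eq ?_)
          ring
      _ = _ := by
          rw [lintegral_const_mul' _ _ (by simp), hk r hr]
  · intro r hr x y
    refine le_trans ?_ (hle r hr x y)
    rw [← lintegral_heatKernel_mul hτ hr]
    exact lintegral_mono fun z =>
      mul_le_mul' (hG.le_heatKernel hτ x z) (hG.le_heatKernel hr z y)
  · exact fun r hr x y => (hG.le_heatKernel (by positivity) x y).trans (hle r hr x y)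
  · intro r hr x y
    -- Both candidates solve the absorption equation with the same source, `G` at time `τ` composed
    -- with the heat kernel. For `G (τ + r)` this comes from splitting its Duhamel integral at `τ`
    -- and cancelling a finite term.
    have h1 : (∫⁻ z, G τ x z * G r z y) +
        duhamelIntegral W (fun s x y => ∫⁻ z, G τ x z * G s z y) r x y =
          ∫⁻ z, G τ x z * heatKernel r z y := by
      have : duhamelIntegral W (fun s x y => ∫⁻ z, G τ x z * G s z y) r x y =
          ∫⁻ w, G τ x w * duhamelIntegral W G r w y :=
        duhamelIntegral_lintegral_mul hW (hGτm x) hGm r x y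
      rw [this, ← lintegral_add_left]
      · congr 1 with z
        rw [← mul_add, hG.formula r hr]
      · exact (hGτm x).mul (measurable_slice hGm (by fun_prop) (by fun_prop) (by fun_prop))
    rw [h1]
    have h2 : (∫⁻ z, G τ x z * heatKernel r z y) +
        ∫⁻ z, duhamelIntegral W G τ x z * heatKernel r z y = heatKernel (τ + r) x y := by
      rw [← lintegral_add_left, ← lintegral_heatKernel_mul hτ hr]
      · congr 1 with z
        rw [← add_mul, hG.formula τ hτ]
      · exact (hGτm x).mul (Measurable.heatKernel (by fun_prop) (by fun_prop) (by fun_prop))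
    have h3 : (∫⁻ z, duhamelIntegral W G τ x z * heatKernel r z y) ≠ ∞ :=
      ne_top_of_le_ne_top (heatKernel_ne_top (τ + r) x y) (h2 ▸ le_add_self)
    rw [← ENNReal.add_left_inj h3, h2, ← hG.formula (τ + r) (by positivity),
      duhamelIntegral_add_time hW hGm hτ hr]
    ring

end Absorption

/-! ### Time integral of the Gaussian bridge in dimension three -/

section Bridge

open Filter Topology

/-- A version of the fundamental theorem of calculus for nonnegative derivatives on open
intervals. -/
theorem lintegral_Ioo_of_hasDerivAt {F f : ℝ → ℝ} {t A B : ℝ} (ht : 0 < t)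
    (hF : ∀ s ∈ Ioo 0 t, HasDerivAt F (f s) s) (hf0 : ∀ s ∈ Ioo 0 t, 0 ≤ f s)
    (hf : ContinuousOn f (Ioo 0 t)) (hA : Tendsto F (𝓝[>] 0) (𝓝 A))
    (hB : Tendsto F (𝓝[<] t) (𝓝 B)) :
    ∫⁻ s in Ioo 0 t, ENNReal.ofReal (f s) = ENNReal.ofReal (B - A) := by
  have hid : Tendsto (fun i : ℝ => i) (𝓝[>] 0) (𝓝 0) := tendsto_id.mono_left nhdsWithin_le_nhds
  have hsub : Tendsto (fun i : ℝ => t - i) (𝓝[>] 0) (𝓝 t) := by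
    simpa using (tendsto_const_nhds (x := t)).sub hid
  have hcov : AECover (volume.restrict (Ioo 0 t)) (𝓝[>] (0 : ℝ)) fun i => Ioc i (t - i) :=
    aecover_Ioo_of_Ioc hid hsub
  refine hcov.lintegral_eq_of_tendsto _ ?_ ?_
  · exact (hf.aestronglyMeasurable measurableSet_Ioo).aemeasurable.ennreal_ofReal
  have hsub' : Tendsto (fun i : ℝ => t - i) (𝓝[>] 0) (𝓝[<] t) := by
    refine tendsto_nhdsWithin_iff.2 ⟨hsub, ?_⟩
    filter_upwards [self_mem_nhdsWithin] with i (hi : 0 < i)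
    simpa using hi
  have hlim : Tendsto (fun i => ENNReal.ofReal (F (t - i) - F i)) (𝓝[>] 0)
      (𝓝 (ENNReal.ofReal (B - A))) :=
    ENNReal.tendsto_ofReal ((hB.comp hsub').sub hA)
  refine hlim.congr' ?_
  filter_upwards [Ioo_mem_nhdsGT (half_pos ht)] with i hi
  have hsubset : Icc i (t - i) ⊆ Ioo 0 t := fun s hs =>
    ⟨hi.1.trans_le hs.1, hs.2.trans_lt (by linarith [hi.1])⟩
  have hle : i ≤ t - i := by linarith [hi.2]
  have hint : IntervalIntegrable f volume i (t - i) :=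
    (hf.mono (by rwa [uIcc_of_le hle])).intervalIntegrable
  rw [Measure.restrict_restrict measurableSet_Ioc,
    inter_eq_left.2 (Ioc_subset_Icc_self.trans hsubset),
    ← ofReal_integral_eq_lintegral_ofReal, ← intervalIntegral.integral_of_le hle,
    intervalIntegral.integral_eq_sub_of_hasDerivAt _ hint]
  · intro s hs
    rw [uIcc_of_le hle] at hs
    exact hF s (hsubset hs)
  · exact (intervalIntegrable_iff_integrableOn_Ioc_of_le hle).1 hint
  · filter_upwards [ae_restrict_mem measurableSet_Ioc] with s hs
    exact hf0 s (hsubset (Ioc_subset_Icc_self hs))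

/-- The primitive of `exp (-x²)` vanishing at `0`. -/
noncomputable def gaussPrimitive (x : ℝ) : ℝ := ∫ u in (0 : ℝ)..x, Real.exp (-u ^ 2)

theorem hasDerivAt_gaussPrimitive (x : ℝ) :
    HasDerivAt gaussPrimitive (Real.exp (-x ^ 2)) x := by
  have hc : Continuous fun u : ℝ => Real.exp (-u ^ 2) := by fun_prop
  exact (hc.integral_hasStrictDerivAt 0 x).hasDerivAt

theorem tendsto_gaussPrimitive_atTop :
    Tendsto gaussPrimitive atTop (𝓝 (√Real.pi / 2)) := by
  have h := integral_gaussian_Ioi 1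
  have hi := integrable_exp_neg_mul_sq (b := 1) one_pos
  simp only [neg_mul, one_mul, div_one] at h hi
  rw [← h]
  exact intervalIntegral_tendsto_integral_Ioi 0 hi.integrableOn tendsto_id

theorem gaussPrimitive_neg (x : ℝ) : gaussPrimitive (-x) = -gaussPrimitive x := by
  unfold gaussPrimitive
  have := intervalIntegral.integral_comp_neg (a := 0) (b := x) fun u : ℝ => Real.exp (-u ^ 2)
  simp only [neg_sq, neg_zero] at this
  rw [this, intervalIntegral.integral_symm]

theorem tendsto_gaussPrimitive_atBot :
    Tendsto gaussPrimitive atBot (𝓝 (-(√Real.pi / 2))) := by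
  have h := (tendsto_gaussPrimitive_atTop.comp tendsto_neg_atBot_atTop).neg
  refine h.congr fun x => ?_
  simp [gaussPrimitive_neg]

variable {t : ℝ}

/-- The substitution `v = √(s / (t - s))` maps `(0, t)` onto `(0, ∞)` and turns the bridge exponent
into `-(q v - p / v)²`. -/
theorem hasDerivAt_sqrt_div_sub {s : ℝ} (hs : s ∈ Ioo 0 t) :
    HasDerivAt (fun s => √(s / (t - s)))
      (t / (2 * √(s / (t - s)) * (t - s) ^ 2)) s := by
  have hts : 0 < t - s := sub_pos.2 hs.2
  have h1 : HasDerivAt (fun s => s / (t - s)) (t / (t - s) ^ 2) s := by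
    convert! (hasDerivAt_id s).div ((hasDerivAt_id s).const_sub t) hts.ne' using 1
    simp
  convert! h1.sqrt (div_pos hs.1 hts).ne' using 1
  have : √(s / (t - s)) ≠ 0 := (Real.sqrt_pos.2 (div_pos hs.1 hts)).ne'
  field_simp

theorem tendsto_sqrt_div_sub_zero (ht : 0 < t) :
    Tendsto (fun s => √(s / (t - s))) (𝓝[>] 0) (𝓝[>] 0) := by
  refine tendsto_nhdsWithin_iff.2 ⟨?_, ?_⟩
  · have : ContinuousAt (fun s => √(s / (t - s))) 0 := by
      apply ContinuousAt.sqrt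
      exact continuousAt_id.div (by fun_prop) (by simpa using ht.ne')
    have h := this.tendsto
    simp only [zero_div, Real.sqrt_zero] at h
    exact h.mono_left nhdsWithin_le_nhds
  · filter_upwards [Ioo_mem_nhdsGT ht] with s hs
    exact Real.sqrt_pos.2 (div_pos hs.1 (sub_pos.2 hs.2))

theorem tendsto_sqrt_div_sub_atTop (ht : 0 < t) :
    Tendsto (fun s => √(s / (t - s))) (𝓝[<] t) atTop := by
  refine Real.tendsto_sqrt_atTop.comp ?_
  simp only [div_eq_mul_inv]
  refine Tendsto.pos_mul_atTop ht (tendsto_id.mono_left nhdsWithin_le_nhds) ?_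
  refine tendsto_inv_nhdsGT_zero.comp (tendsto_nhdsWithin_iff.2 ⟨?_, ?_⟩)
  · have : ContinuousAt (fun s => t - s) t := by fun_prop
    have h := this.tendsto
    simp only [sub_self] at h
    exact h.mono_left nhdsWithin_le_nhds
  · filter_upwards [self_mem_nhdsWithin] with s (hs : s < t)
    exact sub_pos.2 hs

/-- The time integral of the Gaussian bridge in dimension three, in normalized form. -/
theorem lintegral_bridge_normalized {p q : ℝ} (hp : 0 < p) (hq : 0 < q) (ht : 0 < t) :
    ∫⁻ s in Ioo 0 t, ENNReal.ofReal ((1 + (√(s / (t - s)) ^ 2)⁻¹) *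
        Real.exp (-(q * √(s / (t - s)) - p / √(s / (t - s))) ^ 2) *
          (t / (2 * √(s / (t - s)) * (t - s) ^ 2))) =
      ENNReal.ofReal (√Real.pi * ((1 / p + 1 / q) / 2)) := by
  set v : ℝ → ℝ := fun s => √(s / (t - s)) with hv
  have hvpos : ∀ s ∈ Ioo 0 t, 0 < v s := fun s hs =>
    Real.sqrt_pos.2 (div_pos hs.1 (sub_pos.2 hs.2))
  set α := (1 / q + 1 / p) / 2 with hα
  set β := (1 / q - 1 / p) / 2 with hβ
  set e := Real.exp (4 * p * q) with he
  have hvc : ContinuousOn v (Ioo 0 t) := fun s hs =>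
    (hasDerivAt_sqrt_div_sub hs).continuousAt.continuousWithinAt
  -- An explicit antiderivative. Since `e * exp (-(q v + p / v)²) = exp (-(q v - p / v)²)`, the
  -- derivative in `v` has the Gaussian factor times `α (q + p / v²) + β (q - p / v²)`, and `α`, `β`
  -- are chosen to make this `1 + 1 / v²`.
  let F : ℝ → ℝ := fun s => α * gaussPrimitive (q * v s - p / v s) +
    β * e * gaussPrimitive (q * v s + p / v s)
  -- The argument `q v + p / v` tends to `+∞` at both ends, so the `β` term has the same limit at
  -- `0` and at `t` and cancels; only `α * √π` remains.
  have hbot : Tendsto F (𝓝[>] 0) (𝓝 (α * -(√Real.pi / 2) + β * e * (√Real.pi / 2))) := by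
    have h0 := tendsto_sqrt_div_sub_zero ht
    have h1 : Tendsto (fun s => q * v s) (𝓝[>] 0) (𝓝 (q * 0)) :=
      (h0.mono_right nhdsWithin_le_nhds).const_mul q
    have h2 : Tendsto (fun s => p / v s) (𝓝[>] 0) atTop := by
      simp only [div_eq_mul_inv]
      exact (tendsto_inv_nhdsGT_zero.comp h0).const_mul_atTop hp
    refine ((tendsto_gaussPrimitive_atBot.comp ?_).const_mul α).add
      ((tendsto_gaussPrimitive_atTop.comp ?_).const_mul (β * e))
    · simp only [sub_eq_add_neg]
      exact h1.add_atBot (tendsto_neg_atTop_atBot.comp h2)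
    · exact h1.add_atTop h2
  have htop : Tendsto F (𝓝[<] t) (𝓝 (α * (√Real.pi / 2) + β * e * (√Real.pi / 2))) := by
    have h0 := tendsto_sqrt_div_sub_atTop ht
    have h1 : Tendsto (fun s => q * v s) (𝓝[<] t) atTop := h0.const_mul_atTop hq
    have h2 : Tendsto (fun s => p / v s) (𝓝[<] t) (𝓝 0) := h0.const_div_atTop p
    refine ((tendsto_gaussPrimitive_atTop.comp ?_).const_mul α).add
      ((tendsto_gaussPrimitive_atTop.comp ?_).const_mul (β * e))
    · simp only [sub_eq_add_neg]
      exact h1.atTop_add h2.neg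
    · exact h1.atTop_add h2
  rw [lintegral_Ioo_of_hasDerivAt (F := F) ht ?_ ?_ ?_ hbot htop]
  · congr 1
    rw [hα]
    ring
  · intro s hs
    have hvs := hvpos s hs
    have hd := hasDerivAt_sqrt_div_sub hs
    change HasDerivAt v _ s at hd
    set v' := t / (2 * √(s / (t - s)) * (t - s) ^ 2) with hv'
    have hinv : HasDerivAt (fun s => p / v s) (-(p * v' / v s ^ 2)) s := by
      convert! (hasDerivAt_const s p).div hd hvs.ne' using 1
      ring
    have h1 := ((hasDerivAt_gaussPrimitive _).comp s ((hd.const_mul q).sub hinv)).const_mul α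
    have h2 := ((hasDerivAt_gaussPrimitive _).comp s ((hd.const_mul q).add hinv)).const_mul (β * e)
    convert! h1.add h2 using 1
    have hexp : e * Real.exp (-(q * v s + p / v s) ^ 2) =
        Real.exp (-(q * v s - p / v s) ^ 2) := by
      rw [he, ← Real.exp_add]
      congr 1
      field_simp
      ring
    simp only [Pi.add_apply, Pi.sub_apply]
    change (1 + (v s ^ 2)⁻¹) * Real.exp (-(q * v s - p / v s) ^ 2) * v' = _
    calc _ = α * (Real.exp (-(q * v s - p / v s) ^ 2) * (q * v' - -(p * v' / v s ^ 2))) +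
        β * (Real.exp (-(q * v s - p / v s) ^ 2) * (q * v' + -(p * v' / v s ^ 2))) := by
          rw [hα, hβ]
          field_simp
          ring
      _ = _ := by
          rw [← hexp]
          ring
  · intro s hs
    have := hs.1
    have := sub_pos.2 hs.2
    positivity
  · have hts : ∀ s ∈ Ioo 0 t, (2 * v s * (t - s) ^ 2) ≠ 0 := fun s hs => by
      have := hvpos s hs
      have := sub_pos.2 hs.2
      positivity
    refine ContinuousOn.mul (ContinuousOn.mul ?_ ?_) ?_
    · exact continuousOn_const.add ((hvc.pow 2).inv₀ fun s hs => (pow_pos (hvpos s hs) 2).ne')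
    · exact Real.continuous_exp.comp_continuousOn
        (((continuousOn_const.mul hvc).sub
          (continuousOn_const.div hvc fun s hs => (hvpos s hs).ne')).pow 2).neg
    · exact continuousOn_const.div ((continuousOn_const.mul hvc).mul (by fun_prop)) hts

/-- The time integral of a product of two three-dimensional heat kernels is controlled by the
Newtonian kernels. -/
theorem lintegral_heatKernel_mul_le {t : ℝ} (ht : 0 < t) {x y z : RSpace 3} (hx : x ≠ z)
    (hy : y ≠ z) :
    ∫⁻ s in Ioo 0 t, heatKernel s x z * heatKernel (t - s) z y ≤
      ENNReal.ofReal (1 / (4 * Real.pi) * (1 / ‖z - x‖ + 1 / ‖z - y‖)) * heatKernel t x y := by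
  have ha : 0 < ‖z - x‖ := norm_pos_iff.2 (sub_ne_zero.2 hx.symm)
  have hb : 0 < ‖y - z‖ := norm_pos_iff.2 (sub_ne_zero.2 hy)
  have hab : ‖y - x‖ ≤ ‖z - x‖ + ‖y - z‖ := by
    rw [show y - x = (z - x) + (y - z) by abel]
    exact norm_add_le _ _
  rw [norm_sub_rev z y]
  set a := ‖z - x‖ with hadef
  set b := ‖y - z‖ with hbdef
  have hpi := Real.pi_pos
  have hpq := lintegral_bridge_normalized (p := a / (2 * √t)) (q := b / (2 * √t)) (t := t)
    (by positivity) (by positivity) ht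
  set C : ℝ := (4 * Real.pi) ^ (-(3 : ℝ)) * (2 / t ^ 2) * Real.exp (-(a + b) ^ 2 / (4 * t)) with hC
  have hpt : ∀ s ∈ Ioo 0 t, heatKernel s x z * heatKernel (t - s) z y =
      ENNReal.ofReal C * ENNReal.ofReal ((1 + (√(s / (t - s)) ^ 2)⁻¹) *
        Real.exp (-(b / (2 * √t) * √(s / (t - s)) - a / (2 * √t) / √(s / (t - s))) ^ 2) *
          (t / (2 * √(s / (t - s)) * (t - s) ^ 2))) := by
    intro s hs
    have hs0 := hs.1
    have hts := sub_pos.2 hs.2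
    rw [← ENNReal.ofReal_mul (by positivity), heatKernel, heatKernel,
      ← ENNReal.ofReal_mul (gaussWeierstrass_pos hs0 _ _).le]
    congr 1
    unfold gaussWeierstrass
    rw [← hadef, ← hbdef, hC]
    have hsq : √(s / (t - s)) ^ 2 = s / (t - s) := Real.sq_sqrt (by positivity)
    -- Completing the square: the minimum over `s` of `a² / (4s) + b² / (4(t - s))` is `(a + b)² /
    -- (4t)`, which goes into the constant `C`.
    have hexp : -(b / (2 * √t) * √(s / (t - s)) - a / (2 * √t) / √(s / (t - s))) ^ 2 =
        -a ^ 2 / (4 * s) + -b ^ 2 / (4 * (t - s)) + (a + b) ^ 2 / (4 * t) := by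
      have hw : 0 < √(s / (t - s)) := Real.sqrt_pos.2 (by positivity)
      have h2 : (b / (2 * √t) * √(s / (t - s)) - a / (2 * √t) / √(s / (t - s))) ^ 2 =
          b ^ 2 / (4 * √t ^ 2) * √(s / (t - s)) ^ 2 + a ^ 2 / (4 * √t ^ 2) / √(s / (t - s)) ^ 2 -
            2 * a * b / (4 * √t ^ 2) := by
        field_simp
        ring
      rw [h2, hsq, Real.sq_sqrt ht.le]
      field_simp
      ring
    rw [hexp, hsq, Real.exp_add, Real.exp_add]
    have hE : Real.exp (-(a + b) ^ 2 / (4 * t)) * Real.exp ((a + b) ^ 2 / (4 * t)) = 1 := by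
      rw [← Real.exp_add, neg_div, neg_add_cancel, Real.exp_zero]
    have hpre : (4 * Real.pi * s) ^ (-((3 : ℕ) : ℝ) / 2) *
        (4 * Real.pi * (t - s)) ^ (-((3 : ℕ) : ℝ) / 2) =
        (4 * Real.pi) ^ (-(3 : ℝ)) * (2 / t ^ 2) * ((1 + (s / (t - s))⁻¹) *
          (t / (2 * √(s / (t - s)) * (t - s) ^ 2))) := by
      have e1 : ∀ u : ℝ, 0 < u → u ^ (-((3 : ℕ) : ℝ) / 2) = (u * √u)⁻¹ := by
        intro u hu
        rw [show -((3 : ℕ) : ℝ) / 2 = -(1 + 1 / 2) by norm_num, Real.rpow_neg hu.le,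
          Real.rpow_add hu, Real.rpow_one, Real.sqrt_eq_rpow]
      have e2 : (4 * Real.pi) ^ (-(3 : ℝ)) = ((4 * Real.pi) ^ 3)⁻¹ := by
        rw [Real.rpow_neg (by positivity)]
        norm_cast
      rw [Real.mul_rpow (by positivity) hs0.le, Real.mul_rpow (by positivity) hts.le, e1 _ hs0,
        e1 _ hts, e1 _ (by positivity), e2, Real.sqrt_div hs0.le]
      have k1 : √s ≠ 0 := (Real.sqrt_pos.2 hs0).ne'
      have k2 : √(t - s) ≠ 0 := (Real.sqrt_pos.2 hts).ne'
      have k3 : √(4 * Real.pi) ≠ 0 := (Real.sqrt_pos.2 (by positivity)).ne'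
      have k4 : √(4 * Real.pi) ^ 2 = 4 * Real.pi := Real.sq_sqrt (by positivity)
      have k5 : √(t - s) ^ 2 = t - s := Real.sq_sqrt hts.le
      have k6 : 1 + (s / (t - s))⁻¹ = t / s := by field_simp; ring
      rw [k6]
      have k7 : (4 * Real.pi * √(4 * Real.pi))⁻¹ * (4 * Real.pi * √(4 * Real.pi))⁻¹ =
          ((4 * Real.pi) ^ 3)⁻¹ := by
        rw [← mul_inv]
        congr 1
        calc _ = (4 * Real.pi) ^ 2 * √(4 * Real.pi) ^ 2 := by ring
          _ = _ := by rw [k4]; ring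
      rw [← k7]
      have k8 : (s * √s)⁻¹ * ((t - s) * √(t - s))⁻¹ =
          2 / t ^ 2 * (t / s * (t / (2 * (√s / √(t - s)) * (t - s) ^ 2))) := by
        field_simp
        rw [k5]
      calc _ = (4 * Real.pi * √(4 * Real.pi))⁻¹ * (4 * Real.pi * √(4 * Real.pi))⁻¹ *
            ((s * √s)⁻¹ * ((t - s) * √(t - s))⁻¹) := by ring
        _ = _ := by rw [k8]; ring
    calc _ = ((4 * Real.pi * s) ^ (-((3 : ℕ) : ℝ) / 2) *
          (4 * Real.pi * (t - s)) ^ (-((3 : ℕ) : ℝ) / 2)) *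
          (Real.exp (-a ^ 2 / (4 * s)) * Real.exp (-b ^ 2 / (4 * (t - s)))) := by ring
      _ = (4 * Real.pi) ^ (-(3 : ℝ)) * (2 / t ^ 2) * ((1 + (s / (t - s))⁻¹) *
          (t / (2 * √(s / (t - s)) * (t - s) ^ 2))) *
          (Real.exp (-a ^ 2 / (4 * s)) * Real.exp (-b ^ 2 / (4 * (t - s)))) *
          (Real.exp (-(a + b) ^ 2 / (4 * t)) * Real.exp ((a + b) ^ 2 / (4 * t))) := by
            rw [hpre, hE, mul_one]
      _ = _ := by ring
  rw [setLIntegral_congr_fun measurableSet_Ioo hpt, lintegral_const_mul' _ _ ENNReal.ofReal_ne_top,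
    hpq, ← ENNReal.ofReal_mul (by positivity), heatKernel, ← ENNReal.ofReal_mul (by positivity)]
  apply ENNReal.ofReal_le_ofReal
  unfold gaussWeierstrass
  have e3 : (4 * Real.pi * t) ^ (-((3 : ℕ) : ℝ) / 2) = (8 * Real.pi * √Real.pi * (t * √t))⁻¹ := by
    rw [show -((3 : ℕ) : ℝ) / 2 = -(1 + 1 / 2) by norm_num, Real.rpow_neg (by positivity),
      Real.rpow_add (by positivity), Real.rpow_one, ← Real.sqrt_eq_rpow,
      Real.sqrt_mul (by positivity), Real.sqrt_mul (by norm_num),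
      show (4 : ℝ) = 2 ^ 2 by norm_num, Real.sqrt_sq (by norm_num)]
    congr 1
    ring
  have e2 : (4 * Real.pi) ^ (-(3 : ℝ)) = ((4 * Real.pi) ^ 3)⁻¹ := by
    rw [Real.rpow_neg (by positivity)]
    norm_cast
  have hmain : (4 * Real.pi) ^ (-(3 : ℝ)) * (2 / t ^ 2) *
      (√Real.pi * ((1 / (a / (2 * √t)) + 1 / (b / (2 * √t))) / 2)) =
      1 / (4 * Real.pi) * (1 / a + 1 / b) * (4 * Real.pi * t) ^ (-((3 : ℕ) : ℝ) / 2) := by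
    rw [e2, e3]
    have k1 : √t ≠ 0 := (Real.sqrt_pos.2 ht).ne'
    have k2 : √Real.pi ≠ 0 := (Real.sqrt_pos.2 hpi).ne'
    have k3 : √Real.pi ^ 2 = Real.pi := Real.sq_sqrt hpi.le
    have k4 : √t ^ 2 = t := Real.sq_sqrt ht.le
    field_simp
    rw [k3, k4]
    ring
  -- The triangle inequality `‖y - x‖ ≤ a + b` is the only loss in the whole estimate.
  have hexp : Real.exp (-(a + b) ^ 2 / (4 * t)) ≤ Real.exp (-‖y - x‖ ^ 2 / (4 * t)) := by
    apply Real.exp_le_exp.2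
    gcongr
  calc _ = ((4 * Real.pi) ^ (-(3 : ℝ)) * (2 / t ^ 2) *
      (√Real.pi * ((1 / (a / (2 * √t)) + 1 / (b / (2 * √t))) / 2))) *
        Real.exp (-(a + b) ^ 2 / (4 * t)) := by rw [hC]; ring
    _ = 1 / (4 * Real.pi) * (1 / a + 1 / b) * (4 * Real.pi * t) ^ (-((3 : ℕ) : ℝ) / 2) *
        Real.exp (-(a + b) ^ 2 / (4 * t)) := by rw [hmain]
    _ ≤ 1 / (4 * Real.pi) * (1 / a + 1 / b) * (4 * Real.pi * t) ^ (-((3 : ℕ) : ℝ) / 2) *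
        Real.exp (-‖y - x‖ ^ 2 / (4 * t)) := by gcongr
    _ = _ := by ring

end Bridge

/-! ### Newtonian potentials and the contraction for the ball absorption -/

section NewtonPotential

/-- The Newtonian potential of `W` in dimension three. -/
noncomputable def newtonPotential (W : RSpace 3 → ℝ≥0∞) (x : RSpace 3) : ℝ≥0∞ :=
  ∫⁻ z, W z * ENNReal.ofReal (1 / (4 * Real.pi * ‖z - x‖))

theorem measurable_newtonKernel (x : RSpace 3) :
    Measurable fun z : RSpace 3 => ENNReal.ofReal (1 / (4 * Real.pi * ‖z - x‖)) := by
  fun_prop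

/-- By Tonelli the time integral can be taken first, with `z` fixed; the bridge estimate applies off
the null set formed by the two endpoints. -/
theorem duhamelIntegral_heatKernel_le {W : RSpace 3 → ℝ≥0∞} (hW : Measurable W) {t : ℝ}
    (ht : 0 < t) (x y : RSpace 3) :
    duhamelIntegral W heatKernel t x y ≤
      (newtonPotential W x + newtonPotential W y) * heatKernel t x y := by
  have hm := measurable_duhamel_integrand hW measurable_heatKernel t x y
  rw [duhamelIntegral_eq, lintegral_lintegral_swap hm.aemeasurable]
  have hx : ∀ᵐ z : RSpace 3, z ≠ x := Measure.ae_ne volume x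
  have hy : ∀ᵐ z : RSpace 3, z ≠ y := Measure.ae_ne volume y
  calc _ ≤ ∫⁻ z, (W z * ENNReal.ofReal (1 / (4 * Real.pi * ‖z - x‖)) +
        W z * ENNReal.ofReal (1 / (4 * Real.pi * ‖z - y‖))) * heatKernel t x y := by
        refine lintegral_mono_ae ?_
        filter_upwards [hx, hy] with z hzx hzy
        have h1 : ∀ s, heatKernel s x z * W z * heatKernel (t - s) z y =
            W z * (heatKernel s x z * heatKernel (t - s) z y) := fun s => by ring
        simp_rw [h1]
        rw [lintegral_const_mul, ← mul_add, mul_assoc]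
        · gcongr
          refine (lintegral_heatKernel_mul_le ht hzx.symm hzy.symm).trans (le_of_eq ?_)
          rw [← ENNReal.ofReal_add (by positivity) (by positivity)]
          congr 2
          rw [mul_add, one_div_mul_one_div, one_div_mul_one_div]
        · exact (Measurable.heatKernel (by fun_prop) (by fun_prop) (by fun_prop)).mul
            (Measurable.heatKernel (by fun_prop) (by fun_prop) (by fun_prop))
    _ = _ := by
        rw [lintegral_mul_const' _ _ (heatKernel_ne_top t x y), lintegral_add_left]
        · rfl
        · exact hW.mul (measurable_newtonKernel x)

/-- Among the translates of a ball, the centered one maximizes the integral of a radially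
decreasing function. -/
theorem setLIntegral_ball_comp_norm_sub_le {d : ℕ} [Nonempty (Fin d)] {f : ℝ → ℝ≥0∞}
    (hf : AntitoneOn f (Ioi 0)) {r : ℝ} (hr : 0 < r) (x : RSpace d) :
    ∫⁻ z in Metric.ball (0 : RSpace d) r, f ‖z - x‖ ≤
      ∫⁻ z in Metric.ball (0 : RSpace d) r, f ‖z‖ := by
  have hshift : ∫⁻ z in Metric.ball (0 : RSpace d) r, f ‖z - x‖ =
      ∫⁻ z in Metric.ball (-x) r, f ‖z‖ := by
    rw [← lintegral_indicator Metric.isOpen_ball.measurableSet,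
      ← lintegral_indicator Metric.isOpen_ball.measurableSet,
      ← lintegral_add_right_eq_self _ x]
    congr 1 with z
    simp only [indicator, Metric.mem_ball, dist_eq_norm, sub_zero, sub_neg_eq_add,
      add_sub_cancel_right]
  rw [hshift]
  set A := Metric.ball (-x) r with hA
  set B := Metric.ball (0 : RSpace d) r with hB
  have hAm : MeasurableSet A := Metric.isOpen_ball.measurableSet
  have hBm : MeasurableSet B := Metric.isOpen_ball.measurableSet
  -- Removing the intersection leaves two sets of equal volume. On `A \ B` the integrand is at most
  -- `f r`, and on `B \ A`, off the origin, at least `f r`.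
  have hvol : volume (A \ B) = volume (B \ A) := by
    have h1 := measure_inter_add_sdiff (μ := volume) A hBm
    have h2 := measure_inter_add_sdiff (μ := volume) B hAm
    have h3 : volume A = volume B := by
      rw [hA, hB, EuclideanSpace.volume_ball, EuclideanSpace.volume_ball]
    rw [inter_comm B A] at h2
    have hfin : volume (A ∩ B) ≠ ∞ := ne_top_of_le_ne_top
      (measure_ball_lt_top (μ := volume) (x := -x) (r := r)).ne (measure_mono inter_subset_left)
    rw [← ENNReal.add_right_inj hfin, h1, h2, h3]
  rw [← lintegral_inter_add_sdiff (fun z : RSpace d => f ‖z‖) A hBm,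
    ← lintegral_inter_add_sdiff (fun z : RSpace d => f ‖z‖) B hAm, inter_comm B A]
  gcongr 1
  calc ∫⁻ z in A \ B, f ‖z‖ ≤ ∫⁻ _ in A \ B, f r := by
        refine setLIntegral_mono' (hAm.diff hBm) fun z hz => ?_
        have : r ≤ ‖z‖ := by simpa [hB] using hz.2
        exact hf hr (hr.trans_le this) this
    _ = ∫⁻ _ in B \ A, f r := by simp [hvol]
    _ ≤ ∫⁻ z in B \ A, f ‖z‖ := by
        refine lintegral_mono_ae ?_
        have h0 : ∀ᵐ z : RSpace d ∂(volume.restrict (B \ A)), z ≠ 0 :=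
          ae_restrict_of_ae (Measure.ae_ne volume 0)
        filter_upwards [h0, ae_restrict_mem (hBm.diff hAm)] with z hz hzB
        have : ‖z‖ < r := by simpa [hB] using hzB.1
        exact hf (norm_pos_iff.2 hz) hr this.le

theorem lintegral_ball_norm_rpow {ε : ℝ} (hε₁ : ε < 1) {r : ℝ} (hr : 0 < r) :
    ∫⁻ z in Metric.ball (0 : RSpace 3) r, ENNReal.ofReal (‖z‖ ^ (-2 - ε)) =
      ENNReal.ofReal (4 * Real.pi * (r ^ (1 - ε) / (1 - ε))) := by
  have hint : IntegrableOn (fun z : RSpace 3 => ‖z‖ ^ (-2 - ε)) (Metric.ball 0 r) := by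
    refine integrableOn_ball_of_norm_le_rpow (C := 1) (α := 2 + ε) (by simp)
      (by simp; linarith) ?_ (by
        exact (measurable_norm.pow_const _).aestronglyMeasurable)
    refine Filter.Eventually.of_forall fun z => ?_
    rw [Real.norm_of_nonneg (by positivity), one_mul, neg_add']
  rw [← ofReal_integral_eq_lintegral_ofReal hint
    (Filter.Eventually.of_forall fun z => by positivity)]
  congr 1
  rw [← integral_indicator Metric.isOpen_ball.measurableSet]
  have h1 : (Metric.ball (0 : RSpace 3) r).indicator (fun z => ‖z‖ ^ (-2 - ε)) =
      fun z => (Iio r).indicator (fun u => u ^ (-2 - ε)) ‖z‖ := by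
    ext z
    simp [indicator]
  rw [h1, integral_fun_norm_addHaar volume ((Iio r).indicator fun u => u ^ (-2 - ε))]
  have h2 : ∫ y in Ioi (0 : ℝ), y ^ (Module.finrank ℝ (RSpace 3) - 1) •
      (Iio r).indicator (fun u => u ^ (-2 - ε)) y = r ^ (1 - ε) / (1 - ε) := by
    have h3 : ∀ y ∈ Ioi (0 : ℝ), y ^ (Module.finrank ℝ (RSpace 3) - 1) •
        (Iio r).indicator (fun u => u ^ (-2 - ε)) y = (Iio r).indicator (fun u => u ^ (-ε)) y := by
      intro y hy
      have hy' : (0 : ℝ) < y := hy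
      simp only [finrank_euclideanSpace, Fintype.card_fin, indicator]
      split_ifs
      · rw [smul_eq_mul, show 3 - 1 = 2 by rfl, ← Real.rpow_natCast, ← Real.rpow_add hy']
        congr 1
        push_cast
        ring
      · simp
    rw [setIntegral_congr_fun measurableSet_Ioi h3, setIntegral_indicator measurableSet_Iio,
      Ioi_inter_Iio, ← integral_Ioc_eq_integral_Ioo, ← intervalIntegral.integral_of_le hr.le,
      integral_rpow (Or.inl (by linarith)), Real.zero_rpow (by linarith), sub_zero,
      neg_add_eq_sub]
  rw [h2, Measure.real, EuclideanSpace.volume_ball_fin_three]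
  simp only [finrank_euclideanSpace, Fintype.card_fin, ENNReal.ofReal_one, one_pow, one_mul,
    nsmul_eq_mul, smul_eq_mul]
  rw [ENNReal.toReal_ofReal (by positivity)]
  push_cast
  ring

/-- The absorption `((1-ε)/2) |x|^{-1-ε} 1_{|x|<r}` on `ℝ^3`. -/
noncomputable def ballAbsorption (ε r : ℝ) : RSpace 3 → ℝ≥0∞ :=
  indicator {x | ‖x‖ < r} fun x => ENNReal.ofReal ((1 - ε) / 2 * ‖x‖ ^ (-1 - ε))

theorem measurable_ballAbsorption (ε r : ℝ) : Measurable (ballAbsorption ε r) := by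
  unfold ballAbsorption
  exact Measurable.indicator (by fun_prop) (measurableSet_lt (by fun_prop) measurable_const)

/-- Weighted AM-GM separates `‖z‖^(-1-ε) ‖z-x‖⁻¹` into multiples of `‖z‖^(-2-ε)` and `‖z-x‖^(-2-ε)`,
both locally integrable since `2 + ε < 3`. Rearrangement then moves the second singularity to the
origin. The bound is the value of the potential at the origin. -/
theorem newtonPotential_ballAbsorption_le {ε : ℝ} (hε₀ : 0 ≤ ε) (hε₁ : ε < 1) {r : ℝ}
    (hr : 0 < r) (x : RSpace 3) :
    newtonPotential (ballAbsorption ε r) x ≤ ENNReal.ofReal (r ^ (1 - ε) / 2) := by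
  have hpi := Real.pi_pos
  -- The weights solve `(2 + ε) α = 1 + ε` and `(2 + ε) β = 1`, so that both resulting powers are
  -- `-2 - ε`.
  set α := (1 + ε) / (2 + ε) with hα
  set β := 1 / (2 + ε) with hβ
  have hα0 : 0 ≤ α := by positivity
  have hβ0 : 0 ≤ β := by positivity
  have hαβ : α + β = 1 := by rw [hα, hβ]; field_simp; ring
  set c := (1 - ε) / 2 / (4 * Real.pi) with hc
  have hc0 : 0 ≤ c := by
    have : 0 < 1 - ε := by linarith
    positivity
  have hball : {x : RSpace 3 | ‖x‖ < r} = Metric.ball 0 r := by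
    ext z; simp
  have h1 : newtonPotential (ballAbsorption ε r) x =
      ∫⁻ z in Metric.ball (0 : RSpace 3) r, ENNReal.ofReal ((1 - ε) / 2 * ‖z‖ ^ (-1 - ε)) *
        ENNReal.ofReal (1 / (4 * Real.pi * ‖z - x‖)) := by
    rw [newtonPotential, ← lintegral_indicator Metric.isOpen_ball.measurableSet]
    congr 1 with z
    rw [ballAbsorption, hball]
    simp only [indicator]
    split_ifs <;> simp
  have hx : ∀ᵐ z : RSpace 3 ∂(volume.restrict (Metric.ball 0 r)), z ≠ x :=
    ae_restrict_of_ae (Measure.ae_ne volume x)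
  have h0 : ∀ᵐ z : RSpace 3 ∂(volume.restrict (Metric.ball 0 r)), z ≠ 0 :=
    ae_restrict_of_ae (Measure.ae_ne volume 0)
  have hanti : AntitoneOn (fun u : ℝ => ENNReal.ofReal (u ^ (-2 - ε))) (Ioi 0) := by
    intro u hu v hv huv
    exact ENNReal.ofReal_le_ofReal (Real.rpow_le_rpow_of_nonpos hu huv (by linarith))
  calc newtonPotential (ballAbsorption ε r) x
      ≤ ∫⁻ z in Metric.ball (0 : RSpace 3) r,
        (ENNReal.ofReal (c * α) * ENNReal.ofReal (‖z‖ ^ (-2 - ε)) +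
          ENNReal.ofReal (c * β) * ENNReal.ofReal (‖z - x‖ ^ (-2 - ε))) := by
        rw [h1]
        refine lintegral_mono_ae ?_
        filter_upwards [hx, h0] with z hzx hz0
        have hu : 0 < ‖z‖ := norm_pos_iff.2 hz0
        have hv : 0 < ‖z - x‖ := norm_pos_iff.2 (sub_ne_zero.2 hzx)
        rw [← ENNReal.ofReal_mul (by have : 0 < 1 - ε := by linarith
                                     positivity),
          ← ENNReal.ofReal_mul (by positivity), ← ENNReal.ofReal_mul (by positivity),
          ← ENNReal.ofReal_add (by positivity) (by positivity)]
        apply ENNReal.ofReal_le_ofReal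
        have hamgm := Real.geom_mean_le_arith_mean2_weighted hα0 hβ0
          (Real.rpow_nonneg hu.le (-2 - ε)) (Real.rpow_nonneg hv.le (-2 - ε)) hαβ
        rw [← Real.rpow_mul hu.le, ← Real.rpow_mul hv.le,
          show (-2 - ε) * α = -1 - ε by rw [hα]; field_simp; ring,
          show (-2 - ε) * β = -1 by rw [hβ]; field_simp; ring, Real.rpow_neg_one] at hamgm
        calc _ = c * (‖z‖ ^ (-1 - ε) * ‖z - x‖⁻¹) := by
              rw [hc]; field_simp
          _ ≤ c * (α * ‖z‖ ^ (-2 - ε) + β * ‖z - x‖ ^ (-2 - ε)) := by gcongr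
          _ = _ := by ring
    _ = ENNReal.ofReal (c * α) * (∫⁻ z in Metric.ball (0 : RSpace 3) r,
          ENNReal.ofReal (‖z‖ ^ (-2 - ε))) + ENNReal.ofReal (c * β) *
          ∫⁻ z in Metric.ball (0 : RSpace 3) r, ENNReal.ofReal (‖z - x‖ ^ (-2 - ε)) := by
        rw [lintegral_add_left (by fun_prop), lintegral_const_mul' _ _ ENNReal.ofReal_ne_top,
          lintegral_const_mul' _ _ ENNReal.ofReal_ne_top]
    _ ≤ ENNReal.ofReal (c * α) * (∫⁻ z in Metric.ball (0 : RSpace 3) r,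
          ENNReal.ofReal (‖z‖ ^ (-2 - ε))) + ENNReal.ofReal (c * β) *
          ∫⁻ z in Metric.ball (0 : RSpace 3) r, ENNReal.ofReal (‖z‖ ^ (-2 - ε)) := by
        gcongr _ + _ * ?_
        exact setLIntegral_ball_comp_norm_sub_le (f := fun u => ENNReal.ofReal (u ^ (-2 - ε)))
          hanti hr x
    _ = ENNReal.ofReal (r ^ (1 - ε) / 2) := by
        have hε : 0 < 1 - ε := by linarith
        rw [← add_mul, ← ENNReal.ofReal_add (by positivity) (by positivity), ← mul_add, hαβ,
          mul_one, lintegral_ball_norm_rpow hε₁ hr, ← ENNReal.ofReal_mul hc0]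
        congr 1
        rw [hc]
        field_simp

theorem newtonPotential_ballAbsorption_one_le {ε : ℝ} (hε₀ : 0 ≤ ε) (hε₁ : ε < 1)
    (x : RSpace 3) : newtonPotential (ballAbsorption ε 1) x ≤ 1 / 2 := by
  refine (newtonPotential_ballAbsorption_le hε₀ hε₁ one_pos x).trans (le_of_eq ?_)
  rw [Real.one_rpow, ENNReal.ofReal_div_of_pos two_pos]
  simp

/-- Far from the support the Newtonian potential is at most half of its maximum. -/
theorem newtonPotential_ballAbsorption_one_le_of_three_le {ε : ℝ} (hε₀ : 0 ≤ ε) (hε₁ : ε < 1)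
    {x : RSpace 3} (hx : 3 ≤ ‖x‖) : newtonPotential (ballAbsorption ε 1) x ≤ 1 / 4 := by
  have hpi := Real.pi_pos
  calc newtonPotential (ballAbsorption ε 1) x
      ≤ 1 / 2 * newtonPotential (ballAbsorption ε 1) 0 := by
        unfold newtonPotential
        rw [← lintegral_const_mul' _ _ (by simp)]
        refine lintegral_mono_ae ?_
        filter_upwards [Measure.ae_ne volume 0] with z hz
        by_cases hz1 : ‖z‖ < 1
        · have h0 : 0 < ‖z‖ := norm_pos_iff.2 hz
          -- Here `‖z - x‖ ≥ 3 - 1 ≥ 2‖z‖`, so the Newtonian kernel at `x` is at most half of the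
          -- one at the origin.
          have h2 : 2 * ‖z‖ ≤ ‖z - x‖ := by
            have := norm_sub_norm_le x z
            rw [norm_sub_rev] at this
            linarith
          rw [mul_left_comm]
          gcongr
          rw [show (1 / 2 : ℝ≥0∞) = ENNReal.ofReal (1 / 2) by
            rw [ENNReal.ofReal_div_of_pos two_pos]; simp, ← ENNReal.ofReal_mul (by positivity)]
          apply ENNReal.ofReal_le_ofReal
          rw [sub_zero, one_div_mul_one_div]
          apply one_div_le_one_div_of_le (by positivity)
          calc _ = 4 * Real.pi * (2 * ‖z‖) := by ring
            _ ≤ _ := by gcongr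
        · have : ballAbsorption ε 1 z = 0 := by simp [ballAbsorption, hz1]
          simp [this]
    _ ≤ 1 / 2 * (1 / 2) := by
        gcongr
        exact newtonPotential_ballAbsorption_one_le hε₀ hε₁ 0
    _ = 1 / 4 := by
        rw [one_div, one_div, ← ENNReal.mul_inv (by simp) (by simp)]
        norm_num

theorem duhamelIntegral_ballAbsorption_le {ε : ℝ} (hε₀ : 0 ≤ ε) (hε₁ : ε < 1) {r : ℝ}
    (hr : 0 < r) {t : ℝ} (ht : 0 < t) (x y : RSpace 3) :
    duhamelIntegral (ballAbsorption ε r) heatKernel t x y ≤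
      ENNReal.ofReal (r ^ (1 - ε)) * heatKernel t x y := by
  refine (duhamelIntegral_heatKernel_le (measurable_ballAbsorption ε r) ht x y).trans ?_
  gcongr
  calc _ ≤ ENNReal.ofReal (r ^ (1 - ε) / 2) + ENNReal.ofReal (r ^ (1 - ε) / 2) :=
        add_le_add (newtonPotential_ballAbsorption_le hε₀ hε₁ hr x)
          (newtonPotential_ballAbsorption_le hε₀ hε₁ hr y)
    _ = _ := by
        rw [← ENNReal.ofReal_add (by positivity) (by positivity), add_halves]

theorem lintegral_Ioo_exp_le {l : ℝ} (hl : 0 < l) {t : ℝ} (ht : 0 < t) :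
    ∫⁻ s in Ioo 0 t, ENNReal.ofReal (Real.exp (l * s)) ≤
      ENNReal.ofReal (Real.exp (l * t) / l) := by
  have hd : ∀ s, HasDerivAt (fun s => Real.exp (l * s) / l) (Real.exp (l * s)) s := by
    intro s
    convert! (((hasDerivAt_id s).const_mul l).exp).div_const l using 1
    simp
    field_simp
  have hc : Continuous fun s => Real.exp (l * s) / l := by fun_prop
  rw [lintegral_Ioo_of_hasDerivAt ht (fun s _ => hd s) (fun s _ => (Real.exp_pos _).le)
    (by fun_prop) ((hc.tendsto 0).mono_left nhdsWithin_le_nhds)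
    ((hc.tendsto t).mono_left nhdsWithin_le_nhds)]
  apply ENNReal.ofReal_le_ofReal
  simp only [mul_zero, Real.exp_zero]
  have : 0 < 1 / l := by positivity
  linarith

/-- The Duhamel operator of a bounded potential, on an exponentially weighted heat kernel. -/
theorem duhamelIntegral_expHeatKernel_le_of_le {d : ℕ} {W : RSpace d → ℝ≥0∞} {M : ℝ}
    (hM : ∀ z, W z ≤ ENNReal.ofReal M) {l : ℝ} (hl : 0 < l) {t : ℝ} (ht : 0 < t)
    (x y : RSpace d) :
    duhamelIntegral W (expHeatKernel l) t x y ≤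
      ENNReal.ofReal M * ENNReal.ofReal (Real.exp (l * t) / l) * heatKernel t x y := by
  calc _ ≤ ∫⁻ s in Ioo 0 t, ENNReal.ofReal M * heatKernel t x y *
        ENNReal.ofReal (Real.exp (l * s)) := by
        rw [duhamelIntegral_eq]
        refine setLIntegral_mono' measurableSet_Ioo fun s hs => ?_
        calc _ ≤ ∫⁻ z, ENNReal.ofReal M * ENNReal.ofReal (Real.exp (l * s)) *
              (heatKernel s x z * heatKernel (t - s) z y) := by
              refine lintegral_mono fun z => ?_
              unfold expHeatKernel
              calc _ ≤ ENNReal.ofReal (Real.exp (l * s)) * heatKernel s x z * ENNReal.ofReal M *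
                    heatKernel (t - s) z y := by gcongr; exact hM z
                _ = _ := by ring
          _ = _ := by
              rw [lintegral_const_mul' _ _ (by finiteness),
                lintegral_heatKernel_mul hs.1 (sub_pos.2 hs.2), add_sub_cancel]
              ring
    _ = ENNReal.ofReal M * heatKernel t x y *
          ∫⁻ s in Ioo 0 t, ENNReal.ofReal (Real.exp (l * s)) :=
        lintegral_const_mul' _ _ (ENNReal.mul_ne_top ENNReal.ofReal_ne_top
          (heatKernel_ne_top _ _ _))
    _ ≤ ENNReal.ofReal M * heatKernel t x y * ENNReal.ofReal (Real.exp (l * t) / l) := by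
        gcongr
        exact lintegral_Ioo_exp_le hl ht
    _ = _ := by ring

/-- For radius one the unweighted bound has constant 1, which is no contraction. The singular core
has a small potential uniformly in time, while the bounded remainder is tamed by the exponential
weight; each contributes 1/4. -/
theorem exists_isExpContraction_ballAbsorption {ε : ℝ} (hε₀ : 0 ≤ ε) (hε₁ : ε < 1) :
    ∃ l : ℝ, 0 < l ∧ IsExpContraction (ballAbsorption ε 1) l := by
  have hε : 0 < 1 - ε := by linarith
  -- The core radius is chosen so that `r ^ (1 - ε) = 1 / 4`.
  set r : ℝ := (1 / 4) ^ (1 / (1 - ε)) with hr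
  have hr0 : 0 < r := by positivity
  have hr1 : r ≤ 1 := Real.rpow_le_one (by norm_num) (by norm_num) (by positivity)
  have hrε : r ^ (1 - ε) = 1 / 4 := by
    rw [hr, ← Real.rpow_mul (by norm_num), one_div_mul_cancel hε.ne', Real.rpow_one]
  set M := (1 - ε) / 2 * r ^ (-1 - ε) with hM
  have hM0 : 0 < M := by positivity
  let W' : RSpace 3 → ℝ≥0∞ := indicator {x | r ≤ ‖x‖} (ballAbsorption ε 1)
  have hsplit : ballAbsorption ε 1 = fun z => ballAbsorption ε r z + W' z := by
    ext z
    simp only [W', ballAbsorption, indicator, mem_ofPred_eq]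
    by_cases h1 : ‖z‖ < r
    · simp [h1, h1.trans_le hr1, not_le.2 h1]
    · simp [h1, not_lt.1 h1]
  have hW' : ∀ z, W' z ≤ ENNReal.ofReal M := by
    intro z
    simp only [W', ballAbsorption, indicator, mem_ofPred_eq]
    split_ifs with h1 h2
    · apply ENNReal.ofReal_le_ofReal
      rw [hM]
      exact mul_le_mul_of_nonneg_left (Real.rpow_le_rpow_of_nonpos hr0 h1 (by linarith))
        (by positivity)
    · exact zero_le
    · exact zero_le
  -- A remainder bounded by `M` contributes the factor `M / l`, which is 1/4 for `l = 4 * M`.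
  refine ⟨4 * M, by positivity, fun t ht x y => ?_⟩
  rw [hsplit, duhamelIntegral_add_potential (measurable_ballAbsorption ε r)
    (measurable_expHeatKernel _)]
  have h1 : duhamelIntegral (ballAbsorption ε r) (expHeatKernel (4 * M)) t x y ≤
      ENNReal.ofReal (1 / 4) * expHeatKernel (4 * M) t x y := by
    calc _ ≤ duhamelIntegral (ballAbsorption ε r)
          (fun s x z => ENNReal.ofReal (Real.exp (4 * M * t)) * heatKernel s x z) t x y := by
          refine duhamelIntegral_mono_left y fun s hs z => ?_
          unfold expHeatKernel
          gcongr
          exact hs.2.le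
      _ = ENNReal.ofReal (Real.exp (4 * M * t)) *
            duhamelIntegral (ballAbsorption ε r) heatKernel t x y :=
          duhamelIntegral_const_mul ENNReal.ofReal_ne_top _ _ _
      _ ≤ ENNReal.ofReal (Real.exp (4 * M * t)) *
            (ENNReal.ofReal (r ^ (1 - ε)) * heatKernel t x y) := by
          gcongr
          exact duhamelIntegral_ballAbsorption_le hε₀ hε₁ hr0 ht x y
      _ = _ := by rw [hrε, expHeatKernel]; ring
  have h2 : duhamelIntegral W' (expHeatKernel (4 * M)) t x y ≤
      ENNReal.ofReal (1 / 4) * expHeatKernel (4 * M) t x y := by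
    refine (duhamelIntegral_expHeatKernel_le_of_le hW' (by positivity) ht x y).trans
      (le_of_eq ?_)
    rw [expHeatKernel, ← mul_assoc (ENNReal.ofReal (1 / 4)), ← ENNReal.ofReal_mul hM0.le, ← ENNReal.ofReal_mul (by norm_num)]
    congr 2
    field_simp
  refine (add_le_add h1 h2).trans (le_of_eq ?_)
  rw [← add_mul, ← ENNReal.ofReal_add (by norm_num) (by norm_num),
    show (1 / 4 + 1 / 4 : ℝ) = 1 / 2 by norm_num, ENNReal.ofReal_div_of_pos two_pos]
  simp

end NewtonPotential

/-! ### Sharp Gaussian bounds on ℝ³ -/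

section BallPotential

variable {ε : ℝ} {G : ℝ → RSpace 3 → RSpace 3 → ℝ≥0∞}

theorem ballPotential_nonpos (hε₁ : ε < 1) (z : RSpace 3) : ballPotential ε z ≤ 0 := by
  refine indicator_nonpos (fun z _ => ?_) z
  have : 0 ≤ (1 - ε) / 2 := by linarith
  rw [neg_mul, neg_nonpos]
  positivity

theorem measurable_ballPotential (ε : ℝ) : Measurable (ballPotential ε) := by
  unfold ballPotential
  exact Measurable.indicator (by fun_prop) (measurableSet_lt (by fun_prop) measurable_const)

theorem ofReal_neg_ballPotential :
    (fun z => ENNReal.ofReal (-ballPotential ε z)) = ballAbsorption ε 1 := by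
  ext z
  simp only [ballPotential, ballAbsorption, indicator]
  split_ifs <;> simp

theorem ofReal_ballPotential (hε₁ : ε < 1) :
    (fun z => ENNReal.ofReal (ballPotential ε z)) = fun _ => 0 := by
  ext z
  exact ENNReal.ofReal_of_nonpos (ballPotential_nonpos hε₁ z)

/-- The potential is nonpositive, so the positive part drops out; the finiteness condition is
automatic because the Duhamel term is at most the heat kernel. -/
theorem isDuhamelSolution_ballPotential_iff (hε₁ : ε < 1) :
    IsDuhamelSolution (ballPotential ε) G ↔ IsAbsorbedKernel (ballAbsorption ε 1) G := by
  constructor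
  · intro h
    refine ⟨h.measurable, fun t ht x y => ?_⟩
    have := h.formula t ht x y
    rw [ofReal_neg_ballPotential, ofReal_ballPotential hε₁, duhamelIntegral_zero, add_zero] at this
    exact this
  · intro h
    refine ⟨h.measurable, fun t ht x y => ?_, fun t ht x y => ?_⟩
    · rw [ofReal_neg_ballPotential]
      exact (h.duhamelIntegral_le ht x y).trans_lt (heatKernel_ne_top t x y).lt_top
    · rw [ofReal_neg_ballPotential, ofReal_ballPotential hε₁, duhamelIntegral_zero, add_zero]
      exact h.formula t ht x y

theorem exists_isFundamentalSolution_ballPotential (hε₀ : 0 ≤ ε) (hε₁ : ε < 1) :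
    ∃ G, IsFundamentalSolution (ballPotential ε) G := by
  obtain ⟨l, hl, hc⟩ := exists_isExpContraction_ballAbsorption hε₀ hε₁
  have hW := measurable_ballAbsorption ε 1
  obtain ⟨G, hG⟩ := exists_isAbsorbedKernel hW hl.le hc fun t ht x y => by
    simpa using duhamelIntegral_ballAbsorption_le hε₀ hε₁ one_pos ht x y
  refine ⟨G, (isDuhamelSolution_ballPotential_iff hε₁).2 hG, fun H hH t ht x y => ?_⟩
  exact (hG.eq hW hl.le hc ((isDuhamelSolution_ballPotential_iff hε₁).1 hH) ht x y).le

theorem quarter_add_three_quarters : (1 / 4 + 3 / 4 : ℝ≥0∞) = 1 := by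
  rw [ENNReal.div_add_div_same, show (1 + 3 : ℝ≥0∞) = 4 by norm_num]
  exact ENNReal.div_self (by simp) (by simp)

theorem half_add_quarter : (1 / 2 + 1 / 4 : ℝ≥0∞) = 3 / 4 := by
  rw [show (1 / 2 : ℝ≥0∞) = 2 / 4 by
    rw [show (4 : ℝ≥0∞) = 2 * 2 by norm_num, ← ENNReal.mul_div_mul_right 1 2 (c := 2)] <;> simp,
    ENNReal.div_add_div_same, show (2 + 1 : ℝ≥0∞) = 3 by norm_num]

theorem IsAbsorbedKernel.quarter_le {d : ℕ} {W : RSpace d → ℝ≥0∞}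
    {G : ℝ → RSpace d → RSpace d → ℝ≥0∞} (hG : IsAbsorbedKernel W G) {t : ℝ} (ht : 0 < t)
    {x y : RSpace d} (h : duhamelIntegral W heatKernel t x y ≤ 3 / 4 * heatKernel t x y) :
    1 / 4 * heatKernel t x y ≤ G t x y := by
  have h1 := (hG.heatKernel_le_add ht x y).trans (add_le_add_right h _)
  nth_rewrite 1 [← one_mul (heatKernel t x y), ← quarter_add_three_quarters, add_mul] at h1
  refine (ENNReal.add_le_add_iff_right ?_).1 h1
  exact ENNReal.mul_ne_top (ENNReal.div_ne_top (by simp) (by simp)) (heatKernel_ne_top _ _ _)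

theorem IsAbsorbedKernel.exists_quarter_le {d : ℕ} {W : RSpace d → ℝ≥0∞}
    {G : ℝ → RSpace d → RSpace d → ℝ≥0∞} (hG : IsAbsorbedKernel W G) {l : ℝ} (hl : 0 < l)
    (hc : IsExpContraction W l) :
    ∃ δ : ℝ, 0 < δ ∧ ∀ t : ℝ, 0 < t → t ≤ δ → ∀ x y, 1 / 4 * heatKernel t x y ≤ G t x y := by
  have hlog : 0 < Real.log (3 / 2) := Real.log_pos (by norm_num)
  -- Up to this time `exp (l * t) ≤ 3 / 2`, so the contraction factor 1/2 becomes 3/4 without the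
  -- weight.
  refine ⟨Real.log (3 / 2) / l, by positivity, fun t ht htδ x y => hG.quarter_le ht ?_⟩
  calc _ ≤ duhamelIntegral W (expHeatKernel l) t x y :=
        duhamelIntegral_mono_left y fun s hs z => heatKernel_le_expHeatKernel hl.le hs.1.le x z
    _ ≤ 1 / 2 * (ENNReal.ofReal (Real.exp (l * t)) * heatKernel t x y) := hc t ht x y
    _ ≤ 1 / 2 * (ENNReal.ofReal (3 / 2) * heatKernel t x y) := by
        gcongr
        rw [← Real.le_log_iff_exp_le (by norm_num), mul_comm]
        exact (le_div_iff₀ hl).1 htδ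
    _ = 3 / 4 * heatKernel t x y := by
        rw [← mul_assoc]
        congr 1
        rw [show (1 / 2 : ℝ≥0∞) = ENNReal.ofReal (1 / 2) by
          rw [ENNReal.ofReal_div_of_pos two_pos]; simp, ← ENNReal.ofReal_mul (by norm_num),
          show (1 / 2 * (3 / 2) : ℝ) = 3 / 4 by norm_num,
          ENNReal.ofReal_div_of_pos (by norm_num)]
        simp

/-- A Gaussian lower bound for short times propagates to all bounded times. -/
theorem IsAbsorbedKernel.exists_lower_bound_of_le {d : ℕ} {W : RSpace d → ℝ≥0∞}
    {G : ℝ → RSpace d → RSpace d → ℝ≥0∞} (hG : IsAbsorbedKernel W G) (hW : Measurable W)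
    {l : ℝ} (hl : 0 < l) (hc : IsExpContraction W l) (T : ℝ) :
    ∃ c : ℝ≥0∞, c ≠ 0 ∧ ∀ t : ℝ, 0 < t → t ≤ T → ∀ x y, c * heatKernel t x y ≤ G t x y := by
  obtain ⟨δ, hδ, hδG⟩ := hG.exists_quarter_le hl hc
  have key : ∀ n : ℕ, ∃ c : ℝ≥0∞, c ≠ 0 ∧ ∀ t : ℝ, 0 < t → t ≤ 2 ^ n * δ →
      ∀ x y, c * heatKernel t x y ≤ G t x y := by
    intro n
    induction n with
    | zero => exact ⟨1 / 4, by simp, by simpa using hδG⟩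
    | succ n ih =>
      obtain ⟨c, hc0, hcG⟩ := ih
      -- Doubling the time range squares the constant: Chapman-Kolmogorov at `t / 2` uses the lower
      -- bound twice.
      refine ⟨c * c, mul_ne_zero hc0 hc0, fun t ht htn x y => ?_⟩
      have ht2 : 0 < t / 2 := by positivity
      have hle : t / 2 ≤ 2 ^ n * δ := by
        rw [pow_succ] at htn
        linarith
      have hCK := hG.lintegral_mul hW hl.le hc ht2 ht2 x y
      have hCK' := lintegral_heatKernel_mul ht2 ht2 x y
      rw [add_halves] at hCK hCK'
      rw [← hCK, ← hCK', ← lintegral_const_mul]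
      · refine lintegral_mono fun z => ?_
        calc _ = c * heatKernel (t / 2) x z * (c * heatKernel (t / 2) z y) := by ring
          _ ≤ _ := mul_le_mul' (hcG _ ht2 hle x z) (hcG _ ht2 hle z y)
      · exact (Measurable.heatKernel (by fun_prop) (by fun_prop) (by fun_prop)).mul
          (Measurable.heatKernel (by fun_prop) (by fun_prop) (by fun_prop))
  obtain ⟨n, hn⟩ := pow_unbounded_of_one_lt (T / δ) one_lt_two
  obtain ⟨c, hc0, hcG⟩ := key n
  exact ⟨c, hc0, fun t ht htT => hcG t ht (htT.trans ((div_lt_iff₀ hδ).1 hn).le)⟩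

/-- For large times the Brownian bridge is at its midpoint far from the origin with probability
at least one half. -/
theorem exists_half_le_setLIntegral_heatKernel_mul (R : ℝ) :
    ∃ T : ℝ, ∀ t : ℝ, 0 < t → T ≤ t → ∀ x y : RSpace 3, 1 / 2 * heatKernel t x y ≤
      ∫⁻ z in (Metric.ball 0 R)ᶜ, heatKernel (t / 2) x z * heatKernel (t / 2) z y := by
  set v := volume.real (Metric.ball (0 : RSpace 3) R) with hv
  -- The midpoint density is at most `(πt)^(-3/2)`, which is at most `1 / t` once `t ≥ 1`; then `t ≥
  -- 2 * v` gives the ball of volume `v` probability at most 1/2.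
  refine ⟨max 1 (2 * v), fun t ht hT x y => ?_⟩
  have ht1 : 1 ≤ t := (le_max_left _ _).trans hT
  have htv : 2 * v ≤ t := (le_max_right _ _).trans hT
  have ht2 : 0 < t / 2 := by positivity
  have hball : ∫⁻ z in Metric.ball 0 R, heatKernel (t / 2) x z * heatKernel (t / 2) z y ≤
      1 / 2 * heatKernel t x y := by
    calc _ ≤ ∫⁻ _ in Metric.ball (0 : RSpace 3) R, heatKernel t x y * ENNReal.ofReal (1 / t) := by
          refine lintegral_mono fun z => ?_
          simp only
          rw [heatKernel_mul ht2 ht2, add_halves]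
          gcongr
          refine (heatKernel_le (by positivity) _ _).trans (ENNReal.ofReal_le_ofReal ?_)
          have hpi : 1 ≤ Real.pi := by linarith [Real.pi_gt_three]
          have e : 4 * Real.pi * (t / 2 * (t / 2) / t) = Real.pi * t := by field_simp; norm_num
          have h1 : 1 ≤ Real.pi * t := one_le_mul_of_one_le_of_one_le hpi ht1
          rw [e]
          calc (Real.pi * t) ^ (-((3 : ℕ) : ℝ) / 2) ≤ (Real.pi * t) ^ (-1 : ℝ) :=
                Real.rpow_le_rpow_of_exponent_le h1 (by norm_num)
            _ = 1 / (Real.pi * t) := by rw [Real.rpow_neg_one, one_div]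
            _ ≤ 1 / t := one_div_le_one_div_of_le ht (le_mul_of_one_le_left ht.le hpi)
      _ = heatKernel t x y * (ENNReal.ofReal (1 / t) * ENNReal.ofReal v) := by
          rw [setLIntegral_const, hv, ofReal_measureReal (measure_ball_lt_top).ne, mul_assoc]
      _ ≤ heatKernel t x y * ENNReal.ofReal (1 / 2) := by
          rw [← ENNReal.ofReal_mul (by positivity)]
          gcongr
          rw [one_div_mul_eq_div, div_le_iff₀ ht]
          linarith
      _ = _ := by
          rw [mul_comm, ENNReal.ofReal_div_of_pos two_pos]
          simp
  have hsum := lintegral_add_compl (μ := volume)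
    (fun z => heatKernel (t / 2) x z * heatKernel (t / 2) z y)
    (Metric.isOpen_ball (x := (0 : RSpace 3)) (ε := R)).measurableSet
  rw [lintegral_heatKernel_mul ht2 ht2, add_halves] at hsum
  have h1 : 1 / 2 * heatKernel t x y + 1 / 2 * heatKernel t x y ≤ 1 / 2 * heatKernel t x y +
      ∫⁻ z in (Metric.ball 0 R)ᶜ, heatKernel (t / 2) x z * heatKernel (t / 2) z y := by
    rw [← add_mul, ENNReal.add_halves, one_mul]
    nth_rewrite 1 [← hsum]
    gcongr
  refine (ENNReal.add_le_add_iff_left ?_).1 h1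
  exact ENNReal.mul_ne_top (by simp) (heatKernel_ne_top _ _ _)

/-- The endpoints may lie near the singularity, but a midpoint of norm at least 3 makes the sum of
potentials at most `1/2 + 1/4` on each half of the path, whatever the other endpoint. -/
theorem IsAbsorbedKernel.exists_lower_bound_of_ge (hε₀ : 0 ≤ ε) (hε₁ : ε < 1)
    (hG : IsAbsorbedKernel (ballAbsorption ε 1) G) :
    ∃ T : ℝ, ∀ t : ℝ, 0 < t → T ≤ t → ∀ x y, 1 / 32 * heatKernel t x y ≤ G t x y := by
  obtain ⟨l, hl, hc⟩ := exists_isExpContraction_ballAbsorption hε₀ hε₁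
  have hW := measurable_ballAbsorption ε 1
  obtain ⟨T, hT⟩ := exists_half_le_setLIntegral_heatKernel_mul 3
  refine ⟨T, fun t ht hTt x y => ?_⟩
  have ht2 : 0 < t / 2 := by positivity
  have hCK := hG.lintegral_mul hW hl.le hc ht2 ht2 x y
  rw [add_halves] at hCK
  have h1 : ∀ z : RSpace 3, 3 ≤ ‖z‖ → ∀ w,
      newtonPotential (ballAbsorption ε 1) w + newtonPotential (ballAbsorption ε 1) z ≤ 3 / 4 := by
    intro z hz w
    rw [← half_add_quarter]
    exact add_le_add (newtonPotential_ballAbsorption_one_le hε₀ hε₁ w)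
      (newtonPotential_ballAbsorption_one_le_of_three_le hε₀ hε₁ hz)
  rw [← hCK]
  -- The constant is 1/4 for each half of the path, times 1/2 for the probability of a distant
  -- midpoint.
  calc 1 / 32 * heatKernel t x y = 1 / 4 * (1 / 4) * (1 / 2 * heatKernel t x y) := by
        rw [← mul_assoc]
        congr 1
        simp only [one_div]
        rw [← ENNReal.mul_inv (by simp) (by simp), ← ENNReal.mul_inv (by simp) (by simp)]
        norm_num
    _ ≤ 1 / 4 * (1 / 4) *
        ∫⁻ z in (Metric.ball 0 3)ᶜ, heatKernel (t / 2) x z * heatKernel (t / 2) z y := by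
        gcongr
        exact hT t ht hTt x y
    _ = ∫⁻ z in (Metric.ball 0 3)ᶜ,
        1 / 4 * heatKernel (t / 2) x z * (1 / 4 * heatKernel (t / 2) z y) := by
        rw [← lintegral_const_mul' _ _ (by simp [ENNReal.mul_eq_top])]
        congr 1 with z
        ring
    _ ≤ ∫⁻ z in (Metric.ball 0 3)ᶜ, G (t / 2) x z * G (t / 2) z y := by
        refine setLIntegral_mono' (Metric.isOpen_ball.measurableSet.compl) fun z hz => ?_
        have hz3 : 3 ≤ ‖z‖ := by simpa using hz
        refine mul_le_mul' (hG.quarter_le ht2 ?_) (hG.quarter_le ht2 ?_)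
        · refine (duhamelIntegral_heatKernel_le hW ht2 x z).trans ?_
          gcongr
          exact h1 z hz3 x
        · refine (duhamelIntegral_heatKernel_le hW ht2 z y).trans ?_
          gcongr
          rw [add_comm]
          exact h1 z hz3 y
    _ ≤ _ := setLIntegral_le_lintegral _ _

theorem sharpGaussianGlobal_of_isDuhamelSolution (hε₀ : 0 ≤ ε) (hε₁ : ε < 1)
    (hG : IsDuhamelSolution (ballPotential ε) G) : SharpGaussianGlobal G := by
  obtain ⟨l, hl, hc⟩ := exists_isExpContraction_ballAbsorption hε₀ hε₁
  have hG' := (isDuhamelSolution_ballPotential_iff hε₁).1 hG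
  obtain ⟨T, hT⟩ := hG'.exists_lower_bound_of_ge hε₀ hε₁
  obtain ⟨c, hc0, hcG⟩ := hG'.exists_lower_bound_of_le (measurable_ballAbsorption ε 1) hl hc T
  set c' := min c (1 / 32) with hc'
  have hfin : c' ≠ ∞ := ne_top_of_le_ne_top (by simp) (min_le_right c (1 / 32))
  have hpos : c' ≠ 0 := (lt_min (pos_iff_ne_zero.2 hc0) (by simp)).ne'
  have hle1 : c' ≤ 1 := (min_le_right _ _).trans (by simp)
  refine ⟨c'.toReal, 1, ENNReal.toReal_pos hpos hfin, ENNReal.toReal_le_of_le_ofReal zero_le_one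
    (by simpa using hle1), fun t ht x y => ?_⟩
  change _ ≤ G t x y / heatKernel t x y ∧ G t x y / heatKernel t x y ≤ _
  rw [ENNReal.ofReal_toReal hfin, ENNReal.le_div_iff_mul_le
    (Or.inl (heatKernel_ne_zero ht x y)) (Or.inl (heatKernel_ne_top t x y)),
    ENNReal.div_le_iff (heatKernel_ne_zero ht x y) (heatKernel_ne_top t x y),
    ENNReal.ofReal_one, one_mul]
  refine ⟨?_, hG'.le_heatKernel ht x y⟩
  rcases le_total t T with h | h
  · exact (mul_le_mul_left (min_le_left _ _) _).trans (hcG t ht h x y)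
  · exact (mul_le_mul_left (min_le_right _ _) _).trans (hT t ht h x y)

theorem SharpGaussianGlobal.local {d : ℕ} {G : ℝ → RSpace d → RSpace d → ℝ≥0∞}
    (hG : SharpGaussianGlobal G) (T : ℝ) : SharpGaussianLocal T G := by
  obtain ⟨c₁, c₂, h1, h2, h3⟩ := hG
  exact ⟨c₁, c₂, h1, h2, fun t ht _ => h3 t ht⟩

end BallPotential

/-! ### Blow-up for the tensor product on ℝ⁶ -/

section TensorPotential

variable {ε : ℝ}

theorem tensorPotential_ballPotential_nonneg (hε₁ : ε < 1) (z : RSpace (3 + 3)) :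
    0 ≤ tensorPotential (ballPotential ε) (ballPotential ε) z :=
  mul_nonneg_of_nonpos_of_nonpos (ballPotential_nonpos hε₁ _) (ballPotential_nonpos hε₁ _)

theorem measurable_tensorPotential {m n : ℕ} {V₁ : RSpace m → ℝ} {V₂ : RSpace n → ℝ}
    (h₁ : Measurable V₁) (h₂ : Measurable V₂) : Measurable (tensorPotential V₁ V₂) := by
  unfold tensorPotential
  refine (h₁.comp ?_).mul (h₂.comp ?_)
  · exact (WithLp.measurable_toLp 2 _).comp (by fun_prop)
  · exact (WithLp.measurable_toLp 2 _).comp (by fun_prop)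

theorem norm_toLp_castAdd_le {m n : ℕ} (z : RSpace (m + n)) :
    ‖(WithLp.toLp 2 fun i => z (Fin.castAdd n i) : RSpace m)‖ ≤ ‖z‖ := by
  rw [EuclideanSpace.norm_eq, EuclideanSpace.norm_eq]
  apply Real.sqrt_le_sqrt
  rw [Fin.sum_univ_add]
  exact le_add_of_nonneg_right (by positivity)

theorem norm_toLp_natAdd_le {m n : ℕ} (z : RSpace (m + n)) :
    ‖(WithLp.toLp 2 fun j => z (Fin.natAdd m j) : RSpace n)‖ ≤ ‖z‖ := by
  rw [EuclideanSpace.norm_eq, EuclideanSpace.norm_eq]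
  apply Real.sqrt_le_sqrt
  rw [Fin.sum_univ_add]
  exact le_add_of_nonneg_left (by positivity)

/-- On the unit ball `‖z‖^(-1-ε) ≥ ‖z‖⁻¹`. The origin is excluded because zero to a negative real
power is zero here, so the potential vanishes there. -/
theorem inv_le_neg_ballPotential (hε₀ : 0 ≤ ε) (hε₁ : ε < 1) {z : RSpace 3} (hz : z ≠ 0) {u : ℝ}
    (hzu : ‖z‖ ≤ u) (hu : u < 1) : (1 - ε) / 2 * u⁻¹ ≤ -ballPotential ε z := by
  have h0 : 0 < ‖z‖ := norm_pos_iff.2 hz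
  have hz1 : ‖z‖ < 1 := hzu.trans_lt hu
  have : 0 ≤ (1 - ε) / 2 := by linarith
  have hval : ballPotential ε z = -((1 - ε) / 2) * ‖z‖ ^ (-1 - ε) := by
    simp [ballPotential, hz1]
  rw [hval, neg_mul, neg_neg]
  gcongr
  calc u⁻¹ ≤ ‖z‖⁻¹ := by gcongr
    _ = ‖z‖ ^ (-1 : ℝ) := (Real.rpow_neg_one _).symm
    _ ≤ ‖z‖ ^ (-1 - ε) := Real.rpow_le_rpow_of_exponent_ge h0 hz1.le (by linarith)

theorem inv_le_tensorPotential (hε₀ : 0 ≤ ε) (hε₁ : ε < 1) {z : RSpace (3 + 3)}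
    (hz : ∀ i, z i ≠ 0) {u : ℝ} (hzu : ‖z‖ ≤ u) (hu : u < 1) :
    ((1 - ε) / 2) ^ 2 * (u ^ 2)⁻¹ ≤
      tensorPotential (ballPotential ε) (ballPotential ε) z := by
  have hu0 : 0 ≤ u := (norm_nonneg z).trans hzu
  have : 0 ≤ (1 - ε) / 2 := by linarith
  have h1 := inv_le_neg_ballPotential hε₀ hε₁
    (z := WithLp.toLp 2 fun i => z (Fin.castAdd 3 i))
    (fun h => hz (Fin.castAdd 3 0) (by simpa using congrArg (fun v : RSpace 3 => v 0) h))
    ((norm_toLp_castAdd_le z).trans hzu) hu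
  have h2 := inv_le_neg_ballPotential hε₀ hε₁
    (z := WithLp.toLp 2 fun j => z (Fin.natAdd 3 j))
    (fun h => hz (Fin.natAdd 3 0) (by simpa using congrArg (fun v : RSpace 3 => v 0) h))
    ((norm_toLp_natAdd_le z).trans hzu) hu
  unfold tensorPotential
  rw [← neg_mul_neg (ballPotential ε _)]
  calc _ = ((1 - ε) / 2 * u⁻¹) * ((1 - ε) / 2 * u⁻¹) := by ring
    _ ≤ _ := mul_le_mul h1 h2 (by positivity) (le_trans (by positivity) h1)

/-- The center with all coordinates `1 / 4` has norm `√6 / 4 ≤ 3 / 4`, so radius `1 / 8` stays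
inside the unit ball and, since `1 / 8 < 1 / 4`, off the hyperplanes. Scaling by `u` gives a fixed
fraction of the ball of radius `u` on which the potential has its lower bound. -/
theorem exists_ball_avoiding_coordinate_hyperplanes :
    ∃ p : RSpace (3 + 3), ∀ u : ℝ, 0 < u → ∀ z ∈ Metric.ball (u • p) (u / 8),
      ‖z‖ ≤ u ∧ ∀ i, z i ≠ 0 := by
  refine ⟨WithLp.toLp 2 fun _ => 1 / 4, fun u hu z hz => ?_⟩
  set p : RSpace (3 + 3) := WithLp.toLp 2 fun _ => 1 / 4 with hp
  have hpn : ‖p‖ ≤ 3 / 4 := by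
    rw [EuclideanSpace.norm_eq, Real.sqrt_le_left (by norm_num)]
    simp [hp]
    norm_num
  have hz' : ‖z - u • p‖ < u / 8 := by simpa [dist_eq_norm] using hz
  constructor
  · calc ‖z‖ = ‖u • p + (z - u • p)‖ := by congr 1; abel
      _ ≤ ‖u • p‖ + ‖z - u • p‖ := norm_add_le _ _
      _ ≤ u * (3 / 4) + u / 8 := by
          rw [norm_smul, Real.norm_of_nonneg hu.le]
          gcongr
      _ ≤ u := by linarith
  · intro i hi
    have h1 : ‖(z - u • p) i‖ < u / 8 := (PiLp.norm_apply_le _ i).trans_lt hz'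
    have h2 : (z - u • p) i = -(u / 4) := by
      simp [hi, hp]
      ring
    rw [h2, norm_neg, Real.norm_of_nonneg (by positivity)] at h1
    linarith

theorem lintegral_Ioo_inv_eq_top {δ : ℝ} (hδ : 0 < δ) :
    ∫⁻ s in Ioo 0 δ, ENNReal.ofReal s⁻¹ = ∞ := by
  by_contra h
  have hint : IntegrableOn (fun s : ℝ => s⁻¹) (Ioo 0 δ) := by
    refine ⟨by fun_prop, ?_⟩
    rw [hasFiniteIntegral_iff_ofReal]
    · exact lt_top_iff_ne_top.2 h
    · filter_upwards [ae_restrict_mem measurableSet_Ioo] with s hs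
      exact (inv_pos.2 hs.1).le
  have h2 : IntegrableOn (fun s : ℝ => s ^ (-1 : ℝ)) (Ioo 0 δ) := by
    simpa only [Real.rpow_neg_one] using hint
  rw [intervalIntegral.integrableOn_Ioo_rpow_iff hδ] at h2
  exact lt_irrefl _ h2

/-- In dimension six the prefactor has exponent `-3`, and `‖y - x‖² ≤ t` keeps the Gaussian exponent
above `-1/4`. The separate time `t'` allows a bound for the kernel at time `t - s` that does not
depend on `s`. -/
theorem gaussWeierstrass_six_ge {t t' s : ℝ} (ht : 0 < t) (htt' : t ≤ t') (hs : s ≤ t)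
    {x y : RSpace (3 + 3)} (h : ‖y - x‖ ^ 2 ≤ s) :
    ((4 * Real.pi * t') ^ 3)⁻¹ * Real.exp (-(1 / 4)) ≤ gaussWeierstrass t x y := by
  unfold gaussWeierstrass
  have hpi := Real.pi_pos
  have e : (4 * Real.pi * t) ^ (-((3 + 3 : ℕ) : ℝ) / 2) = ((4 * Real.pi * t) ^ 3)⁻¹ := by
    rw [show -((3 + 3 : ℕ) : ℝ) / 2 = -((3 : ℕ) : ℝ) by norm_num, Real.rpow_neg (by positivity),
      Real.rpow_natCast]
  rw [e]
  gcongr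
  rw [neg_div, neg_le_neg_iff, div_le_div_iff₀ (by positivity) (by norm_num)]
  linarith

theorem duhamelIntegral_tensorPotential_eq_top (hε₀ : 0 ≤ ε) (hε₁ : ε < 1) {t : ℝ} (ht : 0 < t) :
    duhamelIntegral (fun z => ENNReal.ofReal
      (tensorPotential (ballPotential ε) (ballPotential ε) z)) heatKernel t
        (0 : RSpace (3 + 3)) 0 = ∞ := by
  have hpi := Real.pi_pos
  obtain ⟨p, hp⟩ := exists_ball_avoiding_coordinate_hyperplanes
  -- For `s < δ` one has `s ≤ t - s`, so both kernels are in their near-diagonal regime, and `√s <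
  -- 1`, so the ball lies in the support of both factors.
  set δ := min (t / 2) 1 with hδ
  have hδ0 : 0 < δ := lt_min (by positivity) one_pos
  have hδt : δ ≤ t / 2 := min_le_left _ _
  have hδ1 : δ ≤ 1 := min_le_right _ _
  set v := volume.real (Metric.ball (0 : RSpace (3 + 3)) 1) with hv
  have hv0 : 0 < v := ENNReal.toReal_pos
    (Metric.measure_ball_pos volume _ one_pos).ne' measure_ball_lt_top.ne
  have hε : 0 < 1 - ε := by linarith
  -- This collects the constants; the powers of `s` are `s⁻³` from the kernel, `s⁻¹` from the
  -- potential and `s³` from the volume of the ball.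
  set K := ((4 * Real.pi) ^ 3)⁻¹ * Real.exp (-(1 / 4)) * ((1 - ε) / 2) ^ 2 *
    (((4 * Real.pi * t) ^ 3)⁻¹ * Real.exp (-(1 / 4))) * ((1 / 8) ^ 6 * v) with hK
  have hK0 : 0 < K := by positivity
  have hinner : ∀ s ∈ Ioo 0 δ, ENNReal.ofReal K * ENNReal.ofReal s⁻¹ ≤
      ∫⁻ z, heatKernel s (0 : RSpace (3 + 3)) z * ENNReal.ofReal
        (tensorPotential (ballPotential ε) (ballPotential ε) z) * heatKernel (t - s) z 0 := by
    intro s hs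
    have hs0 := hs.1
    have hsq : √s ^ 2 = s := Real.sq_sqrt hs0.le
    have hsq0 : 0 < √s := Real.sqrt_pos.2 hs0
    have hsq1 : √s < 1 := by
      rw [Real.sqrt_lt' one_pos]
      linarith [hs.2]
    set B := Metric.ball (√s • p) (√s / 8) with hB
    have hvol : volume B = ENNReal.ofReal (s ^ 3 * ((1 / 8) ^ 6 * v)) := by
      rw [hB, Measure.addHaar_ball _ _ (by positivity), finrank_euclideanSpace, Fintype.card_fin,
        ← ofReal_measureReal measure_ball_lt_top.ne, ← hv, ← ENNReal.ofReal_mul (by positivity)]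
      congr 1
      nth_rewrite 2 [← hsq]
      ring
    calc ENNReal.ofReal K * ENNReal.ofReal s⁻¹ =
        ENNReal.ofReal (((4 * Real.pi * s) ^ 3)⁻¹ * Real.exp (-(1 / 4)) *
          (((1 - ε) / 2) ^ 2 * (√s ^ 2)⁻¹) *
            (((4 * Real.pi * t) ^ 3)⁻¹ * Real.exp (-(1 / 4)))) * volume B := by
          rw [hvol, ← ENNReal.ofReal_mul hK0.le, ← ENNReal.ofReal_mul (by positivity)]
          congr 1
          rw [hK, hsq]
          field_simp
      _ = ∫⁻ _ in B, ENNReal.ofReal (((4 * Real.pi * s) ^ 3)⁻¹ * Real.exp (-(1 / 4)) *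
          (((1 - ε) / 2) ^ 2 * (√s ^ 2)⁻¹) *
            (((4 * Real.pi * t) ^ 3)⁻¹ * Real.exp (-(1 / 4)))) := (setLIntegral_const _ _).symm
      _ ≤ ∫⁻ z in B, heatKernel s 0 z * ENNReal.ofReal
          (tensorPotential (ballPotential ε) (ballPotential ε) z) * heatKernel (t - s) z 0 := by
          refine setLIntegral_mono' Metric.isOpen_ball.measurableSet fun z hz => ?_
          obtain ⟨hzs, hz0⟩ := hp (√s) hsq0 z hz
          have hzs' : ‖z‖ ^ 2 ≤ s := by
            rw [← hsq]
            gcongr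
          unfold heatKernel
          rw [← ENNReal.ofReal_mul (gaussWeierstrass_pos hs0 _ _).le, ← ENNReal.ofReal_mul
            (mul_nonneg (gaussWeierstrass_pos hs0 _ _).le
              (tensorPotential_ballPotential_nonneg hε₁ z))]
          apply ENNReal.ofReal_le_ofReal
          have h1 := gaussWeierstrass_six_ge hs0 le_rfl le_rfl (x := 0) (y := z) (by simpa)
          have h2 := inv_le_tensorPotential hε₀ hε₁ hz0 hzs hsq1
          have h3 := gaussWeierstrass_six_ge (t := t - s) (t' := t) (s := s)
            (by linarith [hs.2]) (by linarith) (by linarith [hs.2]) (x := z) (y := 0) (by simpa)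
          exact mul_le_mul (mul_le_mul h1 h2 (by positivity) (gaussWeierstrass_pos hs0 _ _).le) h3
            (by positivity) (mul_nonneg (gaussWeierstrass_pos hs0 _ _).le
              (tensorPotential_ballPotential_nonneg hε₁ z))
      _ ≤ _ := setLIntegral_le_lintegral _ _
  rw [eq_top_iff]
  calc ∞ = ENNReal.ofReal K * ∫⁻ s in Ioo 0 δ, ENNReal.ofReal s⁻¹ := by
        rw [lintegral_Ioo_inv_eq_top hδ0, ENNReal.mul_top (ENNReal.ofReal_pos.2 hK0).ne']
    _ = ∫⁻ s in Ioo 0 δ, ENNReal.ofReal K * ENNReal.ofReal s⁻¹ :=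
        (lintegral_const_mul' _ _ ENNReal.ofReal_ne_top).symm
    _ ≤ ∫⁻ s in Ioo 0 δ, ∫⁻ z, heatKernel s (0 : RSpace (3 + 3)) z * ENNReal.ofReal
        (tensorPotential (ballPotential ε) (ballPotential ε) z) * heatKernel (t - s) z 0 :=
        setLIntegral_mono' measurableSet_Ioo hinner
    _ ≤ _ := lintegral_mono_set (Ioo_subset_Ioo_right (by linarith))

/-- With no negative part, `G` dominates the heat kernel; inserting this once into the Duhamel
formula bounds `G` below by the divergent integral. -/
theorem IsDuhamelSolution.eq_top_of_tensorPotential (hε₀ : 0 ≤ ε) (hε₁ : ε < 1)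
    {G : ℝ → RSpace (3 + 3) → RSpace (3 + 3) → ℝ≥0∞}
    (hG : IsDuhamelSolution (tensorPotential (ballPotential ε) (ballPotential ε)) G) {t : ℝ}
    (ht : 0 < t) : G t 0 0 = ∞ := by
  have hneg : (fun z => ENNReal.ofReal
      (-tensorPotential (ballPotential ε) (ballPotential ε) z)) = fun _ : RSpace (3 + 3) => 0 := by
    ext z
    exact ENNReal.ofReal_of_nonpos (neg_nonpos.2 (tensorPotential_ballPotential_nonneg hε₁ z))
  have hf : ∀ s : ℝ, 0 < s → ∀ x y, G s x y = heatKernel s x y +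
      duhamelIntegral (fun z => ENNReal.ofReal
        (tensorPotential (ballPotential ε) (ballPotential ε) z)) G s x y := by
    intro s hs x y
    have := hG.formula s hs x y
    rw [hneg, duhamelIntegral_zero, add_zero] at this
    exact this
  rw [eq_top_iff, ← duhamelIntegral_tensorPotential_eq_top hε₀ hε₁ ht, hf t ht]
  refine le_trans ?_ le_add_self
  refine duhamelIntegral_mono_left 0 fun s hs z => ?_
  rw [hf s hs.1]
  exact le_self_add

theorem not_sharpGaussianLocal_of_eq_top {d : ℕ} {G : ℝ → RSpace d → RSpace d → ℝ≥0∞}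
    (hG : ∀ t : ℝ, 0 < t → G t 0 0 = ∞) {T : ℝ} (hT : 0 < T) : ¬ SharpGaussianLocal T G := by
  rintro ⟨c₁, c₂, -, -, h⟩
  have := (h T hT le_rfl 0 0).2
  rw [hG T hT, ENNReal.top_div_of_ne_top ENNReal.ofReal_ne_top, top_le_iff] at this
  exact ENNReal.ofReal_ne_top this

end TensorPotential

theorem mainTheorem4 (ε : ℝ) (hε₀ : 0 ≤ ε) (hε₁ : ε < 1)
    (V₁ V₂ : RSpace 3 → ℝ) (hV₁ : V₁ = ballPotential ε) (hV₂ : V₂ = ballPotential ε)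
    (V : RSpace 6 → ℝ) (hV : V = tensorPotential (m := 3) (n := 3) V₁ V₂) :
    ((∃ G₁, IsFundamentalSolution V₁ G₁) ∧
      ∀ G₁, IsDuhamelSolution V₁ G₁ →
        SharpGaussianGlobal G₁ ∧ ∀ T : ℝ, 0 < T → SharpGaussianLocal T G₁) ∧
    ((∃ G₂, IsFundamentalSolution V₂ G₂) ∧
      ∀ G₂, IsDuhamelSolution V₂ G₂ →
        SharpGaussianGlobal G₂ ∧ ∀ T : ℝ, 0 < T → SharpGaussianLocal T G₂) ∧
    ((∃ G, IsFundamentalSolution V G) ∧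
      ∀ G, IsDuhamelSolution V G →
        ¬ SharpGaussianGlobal G ∧ ∀ T : ℝ, 0 < T → ¬ SharpGaussianLocal T G) := by
  subst hV₁ hV₂ hV
  have h3 : (∃ G₁, IsFundamentalSolution (ballPotential ε) G₁) ∧
      ∀ G₁, IsDuhamelSolution (ballPotential ε) G₁ →
        SharpGaussianGlobal G₁ ∧ ∀ T : ℝ, 0 < T → SharpGaussianLocal T G₁ :=
    ⟨exists_isFundamentalSolution_ballPotential hε₀ hε₁, fun G hG =>
      have h := sharpGaussianGlobal_of_isDuhamelSolution hε₀ hε₁ hG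
      ⟨h, fun T _ => h.local T⟩⟩
  refine ⟨h3, h3, ?_, fun G hG => ?_⟩
  · exact exists_isFundamentalSolution_of_nonneg
      (measurable_tensorPotential (measurable_ballPotential ε) (measurable_ballPotential ε))
      (tensorPotential_ballPotential_nonneg hε₁)
  · have htop : ∀ t : ℝ, 0 < t → G t 0 0 = ∞ := fun t ht =>
      IsDuhamelSolution.eq_top_of_tensorPotential hε₀ hε₁ hG ht
    exact ⟨fun h => not_sharpGaussianLocal_of_eq_top htop one_pos (h.local 1),
      fun T hT => not_sharpGaussianLocal_of_eq_top htop hT⟩
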